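/- **Setting.** Let $s,d\ge 1$ with $sd\ge 2$. A *point* is an $s$-tuple of *elements* of the cube $\{0,1\}^d$, and $\mathsf{EMD}_s(\{0,1\}^d)$ is the set of points, with $\mathsf{EMD}(x,y)=\min_{\pi}\sum_{i=1}^s\|x_i-y_{\pi(i)}\|_1$ over bijections $\pi:[s]\to[s]$. Let $L=\Theta(\log d)$, meaning $2\log_2 d\le L\le K(\log_2 d+1)$ for a constant $K\ge 2$. **Locally dense points.** For $\tau>0$ and $\ell\in\{0,\dots,L\}$, a draw $h\sim\mathcal H(\tau,\ell)$ is given by independent uniform coordinates $i_1,\dots,i_{2^\ell}\in[d]$ and independent bits $C_{u,k}\sim\mathrm{Ber}(\min\{1,d/(\tau 2^{\ell+1})\})$ for $u\in\{0,1\}^{2^\ell}$, $k\in[s]$. With $\varphi(a)=(a_{i_1},\dots,a_{i_{2^\ell}})$ it maps $x$ to $h(x)=(C_{u,k}\cdot\chi(x,u,k))_{u,k}$, where $\chi(x,u,k)=1$ if at least $k$ of the elements of $x$ (counted with multiplicity) satisfy $\varphi(a)=u$, and $0$ otherwise. Given a probability distribution $\mu$ on $\mathsf{EMD}_s(\{0,1\}^d)$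 and $\alpha,\tau>0$, a point $x$ is $(\alpha,\tau)$-*locally dense* for $\mu$ if $\Pr_{u\sim\mu,\,h\sim\mathcal H(\tau,\ell)}[h(x)=h(u)]\ge\alpha$ for all $\ell\in\{0,\dots,L\}$. **The random tree.** For $\Omega\subseteq\{0,1\}^d$ and $\xi>0$, $\textsc{QuadTree}(\Omega,\xi)$ draws, for $\ell=0,\dots,L-1$ independently, a projection $\varphi_\ell:\{0,1\}^d\to\{0,1\}^{2^\ell}$ onto $2^\ell$ independent uniform coordinates, and lets $\varphi_L$ be the identity of $\{0,1\}^d$. The root $v_0$ has depth $0$ and $\mathrm{Elms}(v_0)=\{0,1\}^d$. Every node $v$ at depth $\ell\le L$ has a child $v_u$ for each possible value $u$ of $\varphi_\ell$, with $\mathrm{Elms}(v_u)=\mathrm{Elms}(v)\cap\varphi_\ell^{-1}(u)$. The edge $(v,v_u)$ has weight $\mathbb E\,\|c-c'\|_1$, for independent uniform $c\in\mathrm{Elms}(v)\cap\Omega$ and $c'\in\mathrm{Elms}(v_u)\cap\Omega$, if $\mathrm{Elms}(v_u)\cap\Omega\ne\emptyset$, and weight $\xi d/2^\ell$ otherwise.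 Each $a\in\{0,1\}^d$ is identified with the leaf (at depth $L+1$) whose $\mathrm{Elms}$ contains $a$; $d_T$ is the shortest-path distance in the weighted tree $T$, and $\mathsf{EMD}_T(x,y)=\min_\pi\sum_i d_T(x_i,y_{\pi(i)})$. $\textsc{SampleTree}(\mu,m)$ draws $y_1,\dots,y_m\sim\mu$ independently, lets $\Omega$ be the set of all elements of $y_1,\dots,y_m$ and $\hat\Omega$ the set of all elements of the cube within $\ell_1$-distance $1$ of $\Omega$, and outputs $T\sim\textsc{QuadTree}(\hat\Omega,\xi)$, where $\xi=\Theta(\log(msd/\delta))$ for a parameter $\delta\in(0,1)$. **Lemma.** For all constants $0<c_1\le c_2$ and $K\ge 2$ there are constants $C_0,C>0$ and $k\in\mathbb N$ such that the following holds for all $s,d,L$ as above, all probability distributions $\mu$ on $\mathsf{EMD}_s(\{0,1\}^d)$, all $\alpha,\tau>0$, $\delta\in(0,1)$, all integers $m\ge C_0\log(sd)/\alpha$, all $\xi$ with $c_1\log(msd/\delta)\le\xi\le c_2\log(msd/\delta)$, and all points $x,y$. If $x$ is $(\alpha,\tau)$-locally dense for $\mu$, then over a draw of $T$ from $\textsc{SampleTree}(\mu,m)$,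 $$\mathbb E_T\big[\mathsf{EMD}_T(x,y)\big]\le \mathsf{EMD}(x,y)\cdot C\log\tfrac{msd}{\delta}\Big(\log\log\tfrac{msd}{\delta}\Big)^{k}\cdot\Big(1+\log\Big(\frac{\tau+s}{\mathsf{EMD}(x,y)}+1\Big)\Big),$$ where the right-hand side is read as $0$ if $\mathsf{EMD}(x,y)=0$. -/

import Mathlib

namespace EMDHash

open scoped BigOperators

/-- The Hamming cube `{0,1}^d`; its `ℓ₁` distance is Mathlib's `hammingDist`. -/
abbrev Cube (d : ℕ) := Fin d → Bool

/-- The points of `EMD_s({0,1}^d)`: size-`s` tuples of elements of the cube. -/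
abbrev Point (s d : ℕ) := Fin s → Cube d

/-- The Earth Mover's distance of two `s`-tuples for a ground distance `D`: the minimum over all
bijections `π` of `∑ i, D (x i) (y (π i))` (an infimum over a finite nonempty set). -/
noncomputable def emdOver {X : Type*} {s : ℕ} (D : X → X → ℝ) (x y : Fin s → X) : ℝ :=
  ⨅ π : Equiv.Perm (Fin s), ∑ i, D (x i) (y (π i))

/-- `EMD(x, y)` in `EMD_s({0,1}^d)`. -/
noncomputable def emd {s d : ℕ} (x y : Point s d) : ℝ :=
  emdOver (fun a b => (hammingDist a b : ℝ)) x y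

/-- The projection `a ↦ (a_{i_1}, …, a_{i_t})`. For uniformly random `i` this is a draw from the
hash family `H_t`. -/
def proj {d t : ℕ} (i : Fin t → Fin d) (a : Cube d) : Fin t → Bool := fun j => a (i j)

/-! ### The data-independent hash families and locally dense points -/

/-- `χ(x, u, k)`: at least `k` of the elements of `x` have projection `u`. Here `k` ranges over
`{1, …, s}`, and `k : Fin s` stands for the number `k + 1`. -/
def chi {s d t : ℕ} (i : Fin t → Fin d) (x : Point s d) (u : Fin t → Bool) (k : Fin s) : Bool :=
  decide ((k : ℕ) + 1 ≤ (Finset.univ.filter fun j => proj i (x j) = u).card)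

/-- The hash value `h(x) = (C_{u,k} · χ(x,u,k))_{u,k}` of `x` for coordinates `i` and bits `C`. -/
def hashValue {s d t : ℕ} (i : Fin t → Fin d) (C : (Fin t → Bool) × Fin s → Bool)
    (x : Point s d) : (Fin t → Bool) × Fin s → Bool :=
  fun q => C q && chi i x q.1 q.2

/-- The parameter `d / (τ 2^{ℓ+1})` of the Bernoulli bits, read as `1` when it exceeds `1`. -/
noncomputable def bitProb (d : ℕ) (τ : ℝ) (ℓ : ℕ) : ℝ := min 1 ((d : ℝ) / (τ * 2 ^ (ℓ + 1)))

/-- The probability of the value `c` under `Ber(p)`. -/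
def bernoulliWeight (p : ℝ) (c : Bool) : ℝ := if c then p else 1 - p

/-- `Pr[h(x) = h(u)]` over `u ∼ μ` and `h ∼ H(τ, ℓ)`: the `2^ℓ` coordinates `i` are uniform and
independent, and so are the bits `C_{u,k} ∼ Ber(d / (τ 2^{ℓ+1}))`. -/
noncomputable def collisionProb {s d : ℕ} (μ : PMF (Point s d)) (τ : ℝ) (ℓ : ℕ)
    (x : Point s d) : ℝ :=
  ∑ u : Point s d, (μ u).toReal *
    𝔼 i : Fin (2 ^ ℓ) → Fin d, ∑ C : (Fin (2 ^ ℓ) → Bool) × Fin s → Bool,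
      (∏ q, bernoulliWeight (bitProb d τ ℓ) (C q)) *
        (if hashValue i C x = hashValue i C u then 1 else 0)

/-- `x` is `(α, τ)`-locally dense with respect to `μ`, with levels `0, …, L`. -/
def LocallyDense {s d : ℕ} (L : ℕ) (μ : PMF (Point s d)) (α τ : ℝ) (x : Point s d) : Prop :=
  ∀ ℓ ≤ L, α ≤ collisionProb μ τ ℓ x

/-! ### The random tree `QuadTree(Ω, ξ)` -/

/-- The random choices of `QuadTree`: `2^ℓ` coordinates for each `ℓ = 0, …, L - 1`. -/
abbrev HashSeq (d L : ℕ) := (ℓ : Fin L) → Fin (2 ^ (ℓ : ℕ)) → Fin d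

/-- The value `φ_ℓ(a)`, as a string of bits: the sampled projection for `ℓ < L`, and the identity
for `ℓ = L`. -/
def label {d L : ℕ} (H : HashSeq d L) (ℓ : ℕ) (a : Cube d) : List Bool :=
  if h : ℓ < L then List.ofFn (proj (H ⟨ℓ, h⟩) a) else List.ofFn a

/-- The length of the strings `φ_ℓ(a)`. -/
def labelLength (d L ℓ : ℕ) : ℕ := if ℓ < L then 2 ^ ℓ else d

/-- The nodes of the tree: the root is `[]`, and a node `v` at depth `ℓ ≤ L` has one child
`v_u = u :: v` for every possible value `u` of `φ_ℓ`. The leaves are at depth `L + 1`. -/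
def IsNode (d L : ℕ) : List (List Bool) → Prop
  | [] => True
  | u :: v => v.length ≤ L ∧ u.length = labelLength d L v.length ∧ IsNode d L v

/-- The vertex set of the tree. -/
abbrev Node (d L : ℕ) := {v : List (List Bool) // IsNode d L v}

/-- The depth of a node. -/
def depth {d L : ℕ} (v : Node d L) : ℕ := v.1.length

/-- The tree, as an undirected graph: the edges join every node to its children. -/
def treeGraph (d L : ℕ) : SimpleGraph (Node d L) :=
  SimpleGraph.fromRel fun v w => ∃ u, w.1 = u :: v.1

/-- `Elms(v)`: the elements of the cube in the subtree at `v`. -/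
def elms {d L : ℕ} (H : HashSeq d L) : List (List Bool) → Finset (Cube d)
  | [] => Finset.univ
  | u :: v => (elms H v).filter fun a => label H v.length a = u

open scoped Classical in
/-- The weight `w(v, v_u)` of the edge from a node `v` to its child `w = v_u`. -/
noncomputable def edgeWeight {d L : ℕ} (H : HashSeq d L) (Ω : Finset (Cube d)) (ξ : ℝ)
    (v w : Node d L) : ℝ :=
  if (elms H w.1 ∩ Ω).Nonempty then
    𝔼 c ∈ elms H v.1 ∩ Ω, 𝔼 c' ∈ elms H w.1 ∩ Ω, (hammingDist c c' : ℝ)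
  else (d : ℝ) / 2 ^ depth v * ξ

/-- The weight of an undirected edge: that of the directed edge from the parent to the child. -/
noncomputable def edgeLength {d L : ℕ} (H : HashSeq d L) (Ω : Finset (Cube d)) (ξ : ℝ)
    (v w : Node d L) : ℝ :=
  if depth v < depth w then edgeWeight H Ω ξ v w else edgeWeight H Ω ξ w v

/-- `d_T(v, w)`: the length of the shortest path in the weighted tree. -/
noncomputable def treeDist {d L : ℕ} (H : HashSeq d L) (Ω : Finset (Cube d)) (ξ : ℝ)
    (v w : Node d L) : ℝ :=
  ⨅ p : (treeGraph d L).Walk v w, (p.darts.map fun e => edgeLength H Ω ξ e.fst e.snd).sum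

/-- The node `v_ℓ(a)` on the root-to-leaf path of `a`. -/
def pathNode {d L : ℕ} (H : HashSeq d L) (a : Cube d) : ℕ → List (List Bool)
  | 0 => []
  | ℓ + 1 => label H ℓ a :: pathNode H a ℓ

theorem length_pathNode {d L : ℕ} (H : HashSeq d L) (a : Cube d) (ℓ : ℕ) :
    (pathNode H a ℓ).length = ℓ := by
  induction ℓ with
  | zero => rfl
  | succ ℓ ih => simp [pathNode, ih]

theorem isNode_pathNode {d L : ℕ} (H : HashSeq d L) (a : Cube d) (ℓ : ℕ) (hℓ : ℓ ≤ L + 1) :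
    IsNode d L (pathNode H a ℓ) := by
  induction ℓ with
  | zero => trivial
  | succ ℓ ih =>
    refine ⟨?_, ?_, ih (by omega)⟩
    · rw [length_pathNode]; omega
    · rw [length_pathNode]
      unfold label labelLength
      split_ifs <;> simp

/-- The leaf `v_{L+1}(a)` associated with the element `a`. -/
def leaf {d L : ℕ} (H : HashSeq d L) (a : Cube d) : Node d L :=
  ⟨pathNode H a (L + 1), isNode_pathNode H a (L + 1) le_rfl⟩

/-- `EMD_T(x, y)` for the tree `T` that `QuadTree(Ω, ξ)` outputs on the random choices `H`. -/
noncomputable def treeEMD {s d L : ℕ} (H : HashSeq d L) (Ω : Finset (Cube d)) (ξ : ℝ)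
    (x y : Point s d) : ℝ :=
  emdOver (treeDist H Ω ξ) (fun j => leaf H (x j)) (fun j => leaf H (y j))

/-! ### The random tree `SampleTree(μ, m)` -/

/-- `Ω = y_1 ∪ ⋯ ∪ y_m`. -/
def sampleSet {s d m : ℕ} (Y : Fin m → Point s d) : Finset (Cube d) :=
  Finset.univ.filter fun b => ∃ i j, Y i j = b

/-- `Nbr(Ω)`: all elements of the cube at distance at most `1` from `Ω`. -/
def nbr {d : ℕ} (Ω : Finset (Cube d)) : Finset (Cube d) :=
  Finset.univ.filter fun b' => ∃ b ∈ Ω, hammingDist b b' ≤ 1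

/-- `E_T[EMD_T(x, y)]` over a draw of `T` from `SampleTree(μ, m)`: the samples `y_1, …, y_m ∼ μ`
are independent, and `T` is drawn from `QuadTree(Nbr(y_1 ∪ ⋯ ∪ y_m), ξ)` with uniform and
independent coordinates. -/
noncomputable def expectedTreeEMD {s d : ℕ} (L : ℕ) (μ : PMF (Point s d)) (m : ℕ) (ξ : ℝ)
    (x y : Point s d) : ℝ :=
  ∑ Y : Fin m → Point s d, (∏ i, (μ (Y i)).toReal) *
    𝔼 H : HashSeq d L, treeEMD H (nbr (sampleSet Y)) ξ x y

end EMDHash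

open EMDHash

namespace EMDHash

open scoped BigOperators
open Finset

set_option linter.unusedSectionVars false

/-! ### Uniform expectations over functions -/

section Expect

variable {I J K X : Type*} [Fintype I] [Fintype J] [Fintype K] [DecidableEq I] [DecidableEq J]
  [DecidableEq K] [Fintype X]

/-! Fix the sample and one matched pair `a`, `b` with `D = hammingDist a b`. The tree distance of
their leaves is at most the total weight of the edges below the point where the two paths split. By
the triangle inequality through `a` (or `b`), such an edge weighs at most a constant times the mean
distances from that element to the buckets at its two ends, plus the default weight `ξ d / 2 ^ j` if
the lower bucket is empty. The two contributions are treated separately.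

Mean distances: an element at distance `r` survives `t` random coordinates with probability at most
`exp (-t r / d)`. Gibbs' inequality turns this into a potential argument: sampling `t` more
coordinates lowers `E log (1 + |bucket|)` by at least `t / d` times the new mean distance
(`meanDist_surv_le`). Doubling the number of coordinates telescopes to a total of `O(log |Ω|)` over
all scales (`sum_meanRad_le`). Separation is charged to one sampled coordinate on which `a` and `b`
differ. The other coordinates are independent of it, which gives `D * O(log |Ω|)` in total.

Empty buckets: let `z` be a sampled element at distance `r` from `a`. The tree uses the neighborhood
of the sample, so a single bad coordinate can be repaired by flipping one bit of `z`. Separation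
together with an empty bucket therefore needs two bad coordinates, and its probability is
quadratically small at coarse scales. Only about `log (1 + r / D)` scales then cost `D` each, and
the rest are geometric (`sum_expect_separated_empty_le`).

Local density: a hash collision at level `ℓ` is unlikely if more than about `τ 2 ^ ℓ / d * log (4 /
α)` elements of `x` are at distance over `Z d / 2 ^ ℓ` from the other point. With `m` samples, each
level contributes about `τ`, up to logarithms, to the expected total distance of `x` to the sample
(`sampleMean_sum_distTo_le`). Concavity of the logarithm, applied over the sample and the matching
at once, replaces the individual ratios `r / D` by the ratio of the totals. The polylogarithmic loss
in the distance sits inside a logarithm and costs only one factor `log log`. -/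

theorem expect_sum_arrow (F : (J ⊕ K → X) → ℝ) :
    𝔼 g : J ⊕ K → X, F g = 𝔼 g : J → X, 𝔼 h : K → X, F (Sum.elim g h) := by
  rw [← Finset.expect_product' univ univ (fun g h => F (Sum.elim g h)), Finset.univ_product_univ]
  refine Fintype.expect_equiv (Equiv.sumArrowEquivProdArrow J K X) _ _ fun g => ?_
  congr 1
  ext (i | i) <;> rfl

theorem expect_option_arrow (F : (Option J → X) → ℝ) :
    𝔼 g : Option J → X, F g = 𝔼 i : X, 𝔼 h : J → X, F (fun o => o.elim i h) := by
  rw [← Finset.expect_product' univ univ (fun i h => F (fun o : Option J => o.elim i h)),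
    Finset.univ_product_univ]
  refine Fintype.expect_equiv (Equiv.piOptionEquivProd (β := fun _ => X)) _ _ fun g => ?_
  congr 1
  ext (_ | i) <;> rfl

theorem expect_reindex (e : J ≃ I) (F : (J → X) → ℝ) :
    𝔼 g : I → X, F (g ∘ e) = 𝔼 h : J → X, F h :=
  Fintype.expect_equiv (e.arrowCongr (Equiv.refl X)).symm _ _ fun _ => rfl

/-- Restricting a uniform function along an injection gives a uniform function. -/
theorem expect_comp_injective [Nonempty X] (e : J → I) (he : Function.Injective e)
    (F : (J → X) → ℝ) : 𝔼 g : I → X, F (g ∘ e) = 𝔼 h : J → X, F h := by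
  classical
  let e' : J ⊕ ((Set.range e)ᶜ : Set I) ≃ I :=
    ((Equiv.ofInjective e he).sumCongr (Equiv.refl _)).trans (Equiv.Set.sumCompl (Set.range e))
  have h1 : ∀ g : I → X, F (g ∘ e) =
      (fun f : J ⊕ ((Set.range e)ᶜ : Set I) → X => F (f ∘ Sum.inl)) (g ∘ e') := fun g => rfl
  simp_rw [h1]
  rw [expect_reindex e' (fun f => F (f ∘ Sum.inl)), expect_sum_arrow]
  refine Finset.expect_congr rfl fun g _ => ?_
  simp only [Sum.elim_comp_inl]
  exact Fintype.expect_const _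

theorem expect_prod_arrow (f : J → X → ℝ) :
    𝔼 g : J → X, ∏ k, f k (g k) = ∏ k, 𝔼 i : X, f k i := by
  simp_rw [Fintype.expect_eq_sum_div_card]
  rw [Finset.prod_div_distrib, Finset.prod_univ_sum, Fintype.piFinset_univ]
  simp

end Expect

/-! ### Cube elements that survive random coordinates -/

section Survivors

variable {d : ℕ} {J K : Type*} [Fintype J] [Fintype K] [DecidableEq J] [DecidableEq K]

/-- The elements of `Ω` that agree with `a` on all coordinates `g k`. -/
def surv (Ω : Finset (Cube d)) (a : Cube d) (g : J → Fin d) : Finset (Cube d) :=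
  Ω.filter fun c => ∀ k, c (g k) = a (g k)

theorem surv_subset (Ω : Finset (Cube d)) (a : Cube d) (g : J → Fin d) : surv Ω a g ⊆ Ω :=
  Finset.filter_subset _ _

theorem surv_sum_elim (Ω : Finset (Cube d)) (a : Cube d) (g : J → Fin d) (h : K → Fin d) :
    surv Ω a (Sum.elim g h) = surv (surv Ω a g) a h := by
  ext c
  simp [surv, and_assoc]

/-- The mean distance to `a` of the elements of `S` together with an additional copy of `a`. -/
noncomputable def meanDist (a : Cube d) (S : Finset (Cube d)) : ℝ :=
  (∑ c ∈ S, (hammingDist c a : ℝ)) / (1 + #S)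

theorem meanDist_nonneg (a : Cube d) (S : Finset (Cube d)) : 0 ≤ meanDist a S := by
  unfold meanDist; positivity

theorem hammingDist_le (a b : Cube d) : (hammingDist a b : ℝ) ≤ d := by
  have := hammingDist_le_card_fintype (x := a) (y := b)
  simpa using (Nat.cast_le (α := ℝ)).2 this

theorem meanDist_le (a : Cube d) (S : Finset (Cube d)) : meanDist a S ≤ d := by
  unfold meanDist
  rw [div_le_iff₀ (by positivity)]
  calc ∑ c ∈ S, (hammingDist c a : ℝ) ≤ ∑ _c ∈ S, (d : ℝ) :=
        Finset.sum_le_sum fun c _ => hammingDist_le c a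
    _ = #S * d := by simp
    _ ≤ d * (1 + #S) := by nlinarith [(Nat.cast_nonneg d : (0 : ℝ) ≤ d)]

/-- The probability that all random coordinates agree on `c` and `a`. -/
theorem expect_agree (c a : Cube d) :
    𝔼 g : J → Fin d, (if ∀ k, c (g k) = a (g k) then (1 : ℝ) else 0) =
      (𝔼 i : Fin d, if c i = a i then (1 : ℝ) else 0) ^ Fintype.card J := by
  have h : ∀ g : J → Fin d, (if ∀ k, c (g k) = a (g k) then (1 : ℝ) else 0) =
      ∏ k, if c (g k) = a (g k) then (1 : ℝ) else 0 := fun g => by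
    rw [Finset.prod_ite_zero]; simp
  simp_rw [h]
  rw [expect_prod_arrow (fun _ i => if c i = a i then (1 : ℝ) else 0)]
  simp

theorem expect_ne (c a : Cube d) :
    𝔼 i : Fin d, (if c i ≠ a i then (1 : ℝ) else 0) = hammingDist c a / d := by
  rw [Fintype.expect_eq_sum_div_card, Finset.sum_boole, Fintype.card_fin]
  rfl

theorem expect_eq (hd : 0 < d) (c a : Cube d) :
    𝔼 i : Fin d, (if c i = a i then (1 : ℝ) else 0) = 1 - hammingDist c a / d := by
  have : Nonempty (Fin d) := ⟨⟨0, hd⟩⟩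
  rw [← expect_ne c a, eq_sub_iff_add_eq, ← Finset.expect_add_distrib]
  rw [← Fintype.expect_const (ι := Fin d) (1 : ℝ)]
  refine Finset.expect_congr rfl fun i _ => ?_
  by_cases h : c i = a i <;> simp [h]

theorem expect_agree_le (hd : 0 < d) (c a : Cube d) :
    𝔼 g : J → Fin d, (if ∀ k, c (g k) = a (g k) then (1 : ℝ) else 0) ≤
      Real.exp (-(Fintype.card J / d * hammingDist c a)) := by
  have hd' : (0 : ℝ) < d := by exact_mod_cast hd
  rw [expect_agree, expect_eq hd]
  have h0 : 0 ≤ 1 - (hammingDist c a : ℝ) / d := by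
    rw [sub_nonneg, div_le_one hd']; exact hammingDist_le c a
  calc (1 - (hammingDist c a : ℝ) / d) ^ Fintype.card J
      ≤ Real.exp (-((hammingDist c a : ℝ) / d)) ^ Fintype.card J :=
        pow_le_pow_left₀ h0 (Real.one_sub_le_exp_neg _) _
    _ = _ := by rw [← Real.exp_nat_mul]; congr 1; ring

/-- Gibbs' inequality for a finite set with an additional point of energy `0`. -/
theorem mean_le_log_sum_exp {α : Type*} (S : Finset α) (z : α → ℝ) :
    (∑ c ∈ S, z c) / (1 + #S) + Real.log (1 + #S) ≤ Real.log (1 + ∑ c ∈ S, Real.exp (z c)) := by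
  set A := (∑ c ∈ S, z c) / (1 + #S) with hA
  have hn : (0 : ℝ) < 1 + #S := by positivity
  have hs : ∑ c ∈ S, z c = A * (1 + #S) := (div_mul_cancel₀ _ hn.ne').symm
  have key : Real.exp A * (1 + #S) ≤ 1 + ∑ c ∈ S, Real.exp (z c) := by
    clear_value A
    -- The tangent to `exp` at the mean `A`. Summed over the `z c` and the extra energy `0`, the
    -- linear parts cancel.
    have h1 : ∀ w : ℝ, Real.exp A * (1 + w - A) ≤ Real.exp w := fun w => by
      have := Real.add_one_le_exp (w - A)
      calc Real.exp A * (1 + w - A) ≤ Real.exp A * Real.exp (w - A) := by gcongr; linarith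
        _ = Real.exp w := by rw [← Real.exp_add]; congr 1; ring
    have h2 := h1 0
    have h3 : ∑ c ∈ S, Real.exp A * (1 + z c - A) ≤ ∑ c ∈ S, Real.exp (z c) :=
      Finset.sum_le_sum fun c _ => h1 (z c)
    rw [← Finset.mul_sum, Finset.sum_sub_distrib, Finset.sum_add_distrib, hs] at h3
    simp only [Finset.sum_const, nsmul_eq_mul, mul_one] at h3
    rw [Real.exp_zero] at h2
    nlinarith
  have h4 : Real.log (Real.exp A * (1 + #S)) ≤ _ :=
    Real.log_le_log (mul_pos (Real.exp_pos _) hn) key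
  rwa [Real.log_mul (Real.exp_ne_zero _) hn.ne', Real.log_exp] at h4

/-- Concavity of the logarithm in a form linear in `z`, so that taking expectations yields Jensen's
inequality. -/
theorem log_le_tangent {z z₀ : ℝ} (hz : 0 < z) (h₀ : 0 < z₀) :
    Real.log z ≤ Real.log z₀ + z / z₀ - 1 := by
  have := Real.log_le_sub_one_of_pos (div_pos hz h₀)
  rw [Real.log_div hz.ne' h₀.ne'] at this
  linarith

/-- One step of the potential argument. Weighting each survivor by `exp (lam * distance)`
compensates its survival probability, so the expected weight is at most `#S`. Gibbs' inequality
bounds mean distance plus log-size by the log of the total weight, and Jensen's inequality takes the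
expectation inside. The extra copy of `a` keeps everything meaningful for empty sets. -/
theorem meanDist_surv_le (hd : 0 < d) (S : Finset (Cube d)) (a : Cube d) :
    (Fintype.card K : ℝ) / d * 𝔼 h : K → Fin d, meanDist a (surv S a h) +
      𝔼 h : K → Fin d, Real.log (1 + #(surv S a h)) ≤ Real.log (1 + #S) := by
  have : Nonempty (Fin d) := ⟨⟨0, hd⟩⟩
  have hd' : (0 : ℝ) < d := by exact_mod_cast hd
  set lam : ℝ := Fintype.card K / d with hlam
  have hn : (0 : ℝ) < 1 + #S := by positivity
  set X : (K → Fin d) → ℝ := fun h => ∑ c ∈ surv S a h, Real.exp (lam * hammingDist c a) with hX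
  have hX0 : ∀ h, 0 ≤ X h := fun h => Finset.sum_nonneg fun _ _ => (Real.exp_pos _).le
  have hEX : 𝔼 h, X h ≤ #S := by
    have : ∀ h, X h = ∑ c ∈ S, Real.exp (lam * hammingDist c a) *
        (if ∀ k, c (h k) = a (h k) then (1 : ℝ) else 0) := fun h => by
      simp only [hX, surv, Finset.sum_filter, mul_ite, mul_one, mul_zero]
    simp_rw [this]
    rw [Finset.expect_sum_comm]
    calc _ ≤ ∑ c ∈ S, (1 : ℝ) := by
          refine Finset.sum_le_sum fun c _ => ?_
          rw [← Finset.mul_expect]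
          calc _ ≤ Real.exp (lam * hammingDist c a) * Real.exp (-(lam * hammingDist c a)) := by
                gcongr
                exact expect_agree_le hd c a
            _ = 1 := by rw [← Real.exp_add, add_neg_cancel, Real.exp_zero]
      _ = #S := by simp
  have hpt : ∀ h : K → Fin d, lam * meanDist a (surv S a h) + Real.log (1 + #(surv S a h)) ≤
      Real.log (1 + #S) + (1 + X h) / (1 + #S) - 1 := fun h => by
    have h1 := mean_le_log_sum_exp (surv S a h) (fun c => lam * (hammingDist c a : ℝ))
    rw [← Finset.mul_sum, mul_div_assoc] at h1
    exact h1.trans (log_le_tangent (by linarith [hX0 h]) hn)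
  rw [Finset.mul_expect, ← Finset.expect_add_distrib]
  calc _ ≤ 𝔼 h, (Real.log (1 + #S) + (1 + X h) / (1 + #S) - 1) :=
        Finset.expect_le_expect fun h _ => hpt h
    _ = Real.log (1 + #S) + (1 + 𝔼 h, X h) / (1 + #S) - 1 := by
        rw [Finset.expect_sub_distrib, Finset.expect_add_distrib, ← Finset.expect_div,
          Finset.expect_add_distrib]
        simp only [Fintype.expect_const]
    _ ≤ _ := by
        have : (1 + 𝔼 h, X h) / (1 + #S) ≤ 1 := by rw [div_le_one hn]; linarith
        linarith

/-- `E log (1 + |S|)` for the set `S` of elements of `Ω` that agree with `a` on random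
coordinates. -/
noncomputable def meanLog (Ω : Finset (Cube d)) (a : Cube d) (J : Type*) [Fintype J]
    [DecidableEq J] : ℝ := 𝔼 g : J → Fin d, Real.log (1 + #(surv Ω a g))

/-- The expected mean distance to `a` of the elements of `Ω` that agree with `a` on random
coordinates. -/
noncomputable def meanRad (Ω : Finset (Cube d)) (a : Cube d) (J : Type*) [Fintype J]
    [DecidableEq J] : ℝ := 𝔼 g : J → Fin d, meanDist a (surv Ω a g)

theorem meanRad_sum_le (hd : 0 < d) (Ω : Finset (Cube d)) (a : Cube d) :
    (Fintype.card K : ℝ) / d * meanRad Ω a (J ⊕ K) ≤ meanLog Ω a J - meanLog Ω a (J ⊕ K) := by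
  unfold meanRad meanLog
  rw [expect_sum_arrow, expect_sum_arrow, le_sub_iff_add_le, Finset.mul_expect,
    ← Finset.expect_add_distrib]
  refine Finset.expect_le_expect fun g _ => ?_
  simp_rw [surv_sum_elim]
  exact meanDist_surv_le hd _ a

theorem surv_comp_equiv (Ω : Finset (Cube d)) (a : Cube d) (e : J ≃ K) (g : K → Fin d) :
    surv Ω a (g ∘ e) = surv Ω a g := by
  unfold surv
  congr 1
  ext c
  exact ⟨fun h k => by simpa using h (e.symm k), fun h k => h _⟩

theorem meanRad_congr (Ω : Finset (Cube d)) (a : Cube d) (e : J ≃ K) :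
    meanRad Ω a J = meanRad Ω a K := by
  unfold meanRad
  rw [← expect_reindex e]
  simp_rw [surv_comp_equiv]

theorem meanLog_congr (Ω : Finset (Cube d)) (a : Cube d) (e : J ≃ K) :
    meanLog Ω a J = meanLog Ω a K := by
  unfold meanLog
  rw [← expect_reindex e]
  simp_rw [surv_comp_equiv]

theorem meanRad_add_le (hd : 0 < d) (Ω : Finset (Cube d)) (a : Cube d) (t u : ℕ) :
    (u : ℝ) / d * meanRad Ω a (Fin (t + u)) ≤
      meanLog Ω a (Fin t) - meanLog Ω a (Fin (t + u)) := by
  have := meanRad_sum_le (J := Fin t) (K := Fin u) hd Ω a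
  rwa [meanRad_congr Ω a finSumFinEquiv, meanLog_congr Ω a finSumFinEquiv, Fintype.card_fin]
    at this

theorem meanRad_nonneg (Ω : Finset (Cube d)) (a : Cube d) : 0 ≤ meanRad Ω a J :=
  Finset.expect_nonneg fun _ _ => meanDist_nonneg _ _

theorem meanLog_nonneg (Ω : Finset (Cube d)) (a : Cube d) : 0 ≤ meanLog Ω a J :=
  Finset.expect_nonneg fun _ _ => Real.log_nonneg (by simp)

theorem meanRad_le (hd : 0 < d) (Ω : Finset (Cube d)) (a : Cube d) : meanRad Ω a J ≤ d := by
  have : Nonempty (Fin d) := ⟨⟨0, hd⟩⟩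
  exact Finset.expect_le Finset.univ_nonempty fun g _ => meanDist_le a _

theorem meanLog_le (hd : 0 < d) (Ω : Finset (Cube d)) (a : Cube d) :
    meanLog Ω a J ≤ Real.log (1 + #Ω) := by
  have : Nonempty (Fin d) := ⟨⟨0, hd⟩⟩
  refine Finset.expect_le Finset.univ_nonempty fun g _ => ?_
  have := Finset.card_le_card (surv_subset Ω a g)
  gcongr

/-- The mean distances at dyadic scales, in units of the scales, sum to `O(log |Ω|)`. -/
theorem sum_meanRad_le (hd : 0 < d) (Ω : Finset (Cube d)) (a : Cube d) {e : ℕ} (he : e ≤ 2)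
    (n : ℕ) :
    ∑ j ∈ range n, (2 : ℝ) ^ j / d * meanRad Ω a (Fin (2 ^ j - e)) ≤
      3 + 2 * Real.log (1 + #Ω) := by
  have hd' : (0 : ℝ) < d := by exact_mod_cast hd
  have h0 : ∀ j, 0 ≤ (2 : ℝ) ^ j / d * meanRad Ω a (Fin (2 ^ j - e)) := fun j =>
    mul_nonneg (by positivity) (meanRad_nonneg _ _)
  have hb : ∀ j : ℕ, (2 : ℝ) ^ j / d * meanRad Ω a (Fin (2 ^ j - e)) ≤ 2 ^ j := fun j => by
    rw [div_mul_eq_mul_div, div_le_iff₀ hd']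
    exact mul_le_mul_of_nonneg_left (meanRad_le hd Ω a) (by positivity)
  -- Scales `0` and `1` are bounded trivially by `1 + 2`. Scale `n + 2` has `2 ^ (n + 1)` fresh
  -- coordinates, half of its weight, so it costs twice the drop of the potential. The defect `e` is
  -- constant across scales and disappears in the difference. It will be `1` for the coordinates of
  -- the first `j` levels and `2` when one of them is set aside.
  have main : ∀ n, ∑ j ∈ range (n + 2), (2 : ℝ) ^ j / d * meanRad Ω a (Fin (2 ^ j - e)) ≤
      3 + 2 * (Real.log (1 + #Ω) - meanLog Ω a (Fin (2 ^ (n + 1) - e))) := by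
    intro n
    induction n with
    | zero =>
      rw [Finset.sum_range_succ, Finset.sum_range_one]
      have h1 := hb 0
      have h2 := hb 1
      have h3 := meanLog_le (J := Fin (2 ^ (0 + 1) - e)) hd Ω a
      norm_num at h1 h2 h3 ⊢
      linarith
    | succ n ih =>
      rw [Finset.sum_range_succ]
      have hpow : 1 ≤ 2 ^ n := Nat.one_le_two_pow
      have h1 := meanRad_add_le hd Ω a (2 ^ (n + 1) - e) (2 ^ (n + 1))
      have h2 : 2 ^ (n + 1) - e + 2 ^ (n + 1) = 2 ^ (n + 2) - e := by
        rw [pow_succ, pow_add]; omega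
      rw [h2] at h1
      have h3 : (2 : ℝ) ^ (n + 2) / d * meanRad Ω a (Fin (2 ^ (n + 2) - e)) =
          2 * (((2 ^ (n + 1) : ℕ) : ℝ) / d * meanRad Ω a (Fin (2 ^ (n + 2) - e))) := by
        push_cast; ring
      rw [h3]
      linarith
  calc _ ≤ ∑ j ∈ range (n + 2), (2 : ℝ) ^ j / d * meanRad Ω a (Fin (2 ^ j - e)) :=
        Finset.sum_le_sum_of_subset_of_nonneg (by simp) fun j _ _ => h0 j
    _ ≤ _ := main n
    _ ≤ _ := by
        have := meanLog_nonneg (J := Fin (2 ^ (n + 1) - e)) Ω a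
        linarith

end Survivors

/-! ### Distances in the tree -/

section Tree

variable {d L : ℕ}

/-- The node at depth `j` on the path of `a`. -/
def pathVertex (H : HashSeq d L) (a : Cube d) (j : ℕ) (hj : j ≤ L + 1) : Node d L :=
  ⟨pathNode H a j, isNode_pathNode H a j hj⟩

/-- The weight of the edge at depth `j` on the path of `a`. -/
noncomputable def pathWeight (H : HashSeq d L) (Ω : Finset (Cube d)) (ξ : ℝ) (a : Cube d)
    (j : ℕ) : ℝ :=
  if h : j + 1 ≤ L + 1 then
    edgeWeight H Ω ξ (pathVertex H a j (by omega)) (pathVertex H a (j + 1) h) else 0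

theorem edgeWeight_nonneg (H : HashSeq d L) (Ω : Finset (Cube d)) {ξ : ℝ} (hξ : 0 ≤ ξ)
    (v w : Node d L) : 0 ≤ edgeWeight H Ω ξ v w := by
  unfold edgeWeight
  split_ifs
  · exact Finset.expect_nonneg fun _ _ => Finset.expect_nonneg fun _ _ => by positivity
  · positivity

theorem edgeLength_nonneg (H : HashSeq d L) (Ω : Finset (Cube d)) {ξ : ℝ} (hξ : 0 ≤ ξ)
    (v w : Node d L) : 0 ≤ edgeLength H Ω ξ v w := by
  unfold edgeLength
  split_ifs <;> exact edgeWeight_nonneg H Ω hξ _ _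

theorem pathWeight_nonneg (H : HashSeq d L) (Ω : Finset (Cube d)) {ξ : ℝ} (hξ : 0 ≤ ξ)
    (a : Cube d) (j : ℕ) : 0 ≤ pathWeight H Ω ξ a j := by
  unfold pathWeight
  split_ifs
  · exact edgeWeight_nonneg H Ω hξ _ _
  · exact le_rfl

/-- The length of a walk. -/
noncomputable def walkLength (H : HashSeq d L) (Ω : Finset (Cube d)) (ξ : ℝ) {v w : Node d L}
    (p : (treeGraph d L).Walk v w) : ℝ :=
  (p.darts.map fun e => edgeLength H Ω ξ e.fst e.snd).sum

theorem treeDist_le (H : HashSeq d L) (Ω : Finset (Cube d)) {ξ : ℝ} (hξ : 0 ≤ ξ) {v w : Node d L}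
    (p : (treeGraph d L).Walk v w) : treeDist H Ω ξ v w ≤ walkLength H Ω ξ p := by
  refine ciInf_le ⟨0, ?_⟩ p
  rintro _ ⟨q, rfl⟩
  refine List.sum_nonneg fun r hr => ?_
  obtain ⟨e, -, rfl⟩ := List.mem_map.1 hr
  exact edgeLength_nonneg H Ω hξ _ _

theorem adj_pathVertex (H : HashSeq d L) (a : Cube d) (j : ℕ) (hj : j + 1 ≤ L + 1) :
    (treeGraph d L).Adj (pathVertex H a j (by omega)) (pathVertex H a (j + 1) hj) := by
  rw [treeGraph, SimpleGraph.fromRel_adj]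
  refine ⟨fun h => ?_, Or.inl ⟨label H j a, rfl⟩⟩
  have := congrArg (fun v : Node d L => v.1.length) h
  simp [pathVertex, length_pathNode] at this

theorem edgeLength_pathVertex (H : HashSeq d L) (Ω : Finset (Cube d)) (ξ : ℝ) (a : Cube d) (j : ℕ)
    (hj : j + 1 ≤ L + 1) :
    edgeLength H Ω ξ (pathVertex H a j (by omega)) (pathVertex H a (j + 1) hj) =
      pathWeight H Ω ξ a j ∧
    edgeLength H Ω ξ (pathVertex H a (j + 1) hj) (pathVertex H a j (by omega)) =
      pathWeight H Ω ξ a j := by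
  unfold edgeLength pathWeight
  simp [depth, pathVertex, length_pathNode, hj]

theorem exists_walks (H : HashSeq d L) (Ω : Finset (Cube d)) (ξ : ℝ) (a : Cube d) (n : ℕ) :
    ∀ (j : ℕ) (hj : j + n = L + 1),
      (∃ p : (treeGraph d L).Walk (pathVertex H a j (by omega)) (leaf H a),
        walkLength H Ω ξ p = ∑ i ∈ range n, pathWeight H Ω ξ a (j + i)) ∧
      ∃ p : (treeGraph d L).Walk (leaf H a) (pathVertex H a j (by omega)),
        walkLength H Ω ξ p = ∑ i ∈ range n, pathWeight H Ω ξ a (j + i) := by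
  induction n with
  | zero =>
    intro j hj
    obtain rfl : j = L + 1 := by omega
    exact ⟨⟨SimpleGraph.Walk.nil, by rw [range_zero, sum_empty]; rfl⟩,
      ⟨SimpleGraph.Walk.nil, by rw [range_zero, sum_empty]; rfl⟩⟩
  | succ n ih =>
    intro j hj
    obtain ⟨⟨p, hp⟩, ⟨q, hq⟩⟩ := ih (j + 1) (by omega)
    have hadj := adj_pathVertex H a j (by omega)
    have hlen := edgeLength_pathVertex H Ω ξ a j (by omega)
    have hsum : ∑ i ∈ range (n + 1), pathWeight H Ω ξ a (j + i) =
        ∑ i ∈ range n, pathWeight H Ω ξ a (j + 1 + i) + pathWeight H Ω ξ a j := by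
      rw [Finset.sum_range_succ']
      simp only [add_assoc, add_comm 1, add_zero]
    refine ⟨⟨SimpleGraph.Walk.cons hadj p, ?_⟩, ⟨q.concat hadj.symm, ?_⟩⟩
    · rw [hsum, ← hp, ← hlen.1]
      simp [walkLength, add_comm]
    · rw [hsum, ← hq, ← hlen.2]
      simp [walkLength]

/-- The event that the paths of `a` and `b` have separated before depth `j + 1`. -/
def Separated (H : HashSeq d L) (a b : Cube d) (j : ℕ) : Prop :=
  ∃ l ≤ j, label H l a ≠ label H l b

theorem pathNode_eq_of_not_separated (H : HashSeq d L) (a b : Cube d) (j : ℕ)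
    (h : ∀ l < j, label H l a = label H l b) : pathNode H a j = pathNode H b j := by
  induction j with
  | zero => rfl
  | succ j ih => rw [pathNode, pathNode, h j (by omega), ih fun l hl => h l (by omega)]

open scoped Classical in
-- The walk goes up from `a` to the deepest common node of the two paths and down to `b`. It uses
-- exactly the edges at depths where the paths have already separated.
theorem treeDist_leaf_le (H : HashSeq d L) (Ω : Finset (Cube d)) {ξ : ℝ} (hξ : 0 ≤ ξ)
    (a b : Cube d) :
    treeDist H Ω ξ (leaf H a) (leaf H b) ≤ ∑ j ∈ range (L + 1),
      if Separated H a b j then pathWeight H Ω ξ a j + pathWeight H Ω ξ b j else 0 := by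
  by_cases hab : a = b
  · subst hab
    refine (treeDist_le H Ω hξ SimpleGraph.Walk.nil).trans ?_
    simp [walkLength, Separated]
  have hex : ∃ l, label H l a ≠ label H l b := by
    refine ⟨L, ?_⟩
    simpa [label] using hab
  set l := Nat.find hex with hl
  have hlL : l ≤ L := Nat.find_min' hex (by simpa [label] using hab)
  have hmin : ∀ i < l, label H i a = label H i b := fun i hi => not_not.1 (Nat.find_min hex hi)
  obtain ⟨-, p, hp⟩ := exists_walks H Ω ξ a (L + 1 - l) l (by omega)
  obtain ⟨⟨q, hq⟩, -⟩ := exists_walks H Ω ξ b (L + 1 - l) l (by omega)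
  have hv : pathVertex H a l (by omega) = pathVertex H b l (by omega) :=
    Subtype.ext (pathNode_eq_of_not_separated H a b l hmin)
  refine (treeDist_le H Ω hξ (p.append (q.copy hv.symm rfl))).trans ?_
  have hw : walkLength H Ω ξ (p.append (q.copy hv.symm rfl)) =
      ∑ i ∈ range (L + 1 - l), (pathWeight H Ω ξ a (l + i) + pathWeight H Ω ξ b (l + i)) := by
    rw [Finset.sum_add_distrib, ← hp, ← hq]
    simp [walkLength]
  rw [hw, ← Finset.sum_Ico_eq_sum_range
    (fun j => pathWeight H Ω ξ a j + pathWeight H Ω ξ b j), Finset.range_eq_Ico]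
  have hnn : ∀ j, 0 ≤ pathWeight H Ω ξ a j + pathWeight H Ω ξ b j := fun j =>
    add_nonneg (pathWeight_nonneg H Ω hξ a j) (pathWeight_nonneg H Ω hξ b j)
  calc _ = ∑ j ∈ Ico l (L + 1),
        if Separated H a b j then pathWeight H Ω ξ a j + pathWeight H Ω ξ b j else 0 := by
        refine Finset.sum_congr rfl fun j hj => ?_
        rw [if_pos ⟨l, (Finset.mem_Ico.1 hj).1, Nat.find_spec hex⟩]
    _ ≤ _ := by
        refine Finset.sum_le_sum_of_subset_of_nonneg (Finset.Ico_subset_Ico (by omega) le_rfl)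
          fun j _ _ => ?_
        split_ifs
        · exact hnn j
        · exact le_rfl

theorem mem_elms_pathNode (H : HashSeq d L) (a c : Cube d) (j : ℕ) :
    c ∈ elms H (pathNode H a j) ↔ ∀ l < j, label H l c = label H l a := by
  induction j with
  | zero => simp [pathNode, elms]
  | succ j ih =>
    rw [pathNode, elms, Finset.mem_filter, ih, length_pathNode]
    exact ⟨fun h l hl => (Nat.lt_succ_iff_lt_or_eq.1 hl).elim (h.1 l) fun e => e ▸ h.2,
      fun h => ⟨fun l hl => h l (by omega), h j (by omega)⟩⟩

/-- The elements of `Ω` in the subtree at depth `j` on the path of `a`. -/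
def bucket (H : HashSeq d L) (Ω : Finset (Cube d)) (a : Cube d) (j : ℕ) : Finset (Cube d) :=
  Ω.filter fun c => ∀ l < j, label H l c = label H l a

theorem bucket_antitone (H : HashSeq d L) (Ω : Finset (Cube d)) (a : Cube d) (j : ℕ) :
    bucket H Ω a (j + 1) ⊆ bucket H Ω a j := fun c hc => by
  rw [bucket, Finset.mem_filter] at hc ⊢
  exact ⟨hc.1, fun l hl => hc.2 l (by omega)⟩

/-- The factor `2` pays for the extra copy of `a`: `1 + #S ≤ 2 * #S` for nonempty `S`. -/
theorem expect_hammingDist_le_meanDist (a : Cube d) {S : Finset (Cube d)} (hS : S.Nonempty) :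
    𝔼 c ∈ S, (hammingDist c a : ℝ) ≤ 2 * meanDist a S := by
  have h1 : (1 : ℝ) ≤ #S := by exact_mod_cast hS.card_pos
  have h0 : 0 ≤ ∑ c ∈ S, (hammingDist c a : ℝ) := Finset.sum_nonneg fun _ _ => by positivity
  rw [Finset.expect_eq_sum_div_card, meanDist, div_le_iff₀ (by linarith), mul_div_assoc',
    div_mul_eq_mul_div, le_div_iff₀ (by linarith)]
  nlinarith

open scoped Classical in
/-- The weight of an edge on the path of `a` in terms of mean distances to `a`. -/
theorem pathWeight_le (H : HashSeq d L) (Ω : Finset (Cube d)) (ξ : ℝ) (a : Cube d)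
    {j : ℕ} (hj : j ≤ L) :
    pathWeight H Ω ξ a j ≤ 2 * meanDist a (bucket H Ω a j) +
      2 * meanDist a (bucket H Ω a (j + 1)) +
      ξ * (d / 2 ^ j * if bucket H Ω a (j + 1) = ∅ then 1 else 0) := by
  have hb : ∀ i, elms H (pathNode H a i) ∩ Ω = bucket H Ω a i := fun i => by
    ext c
    rw [Finset.mem_inter, mem_elms_pathNode, bucket, Finset.mem_filter, and_comm]
  have h0 := meanDist_nonneg a (bucket H Ω a j)
  have h1 := meanDist_nonneg a (bucket H Ω a (j + 1))
  rw [pathWeight, dif_pos (by omega), edgeWeight]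
  simp only [pathVertex, depth, length_pathNode]
  by_cases hne : (bucket H Ω a (j + 1)).Nonempty
  · rw [if_pos (by convert hne using 1; exact_mod_cast hb (j + 1)), if_neg hne.ne_empty]
    have hne' := hne.mono (bucket_antitone H Ω a j)
    simp only [hb]
    -- The triangle inequality through `a` decouples the two ends of the edge.
    calc _ ≤ 𝔼 c ∈ bucket H Ω a j, 𝔼 c' ∈ bucket H Ω a (j + 1),
          ((hammingDist c a : ℝ) + hammingDist c' a) := by
          refine Finset.expect_le_expect fun c _ => Finset.expect_le_expect fun c' _ => ?_
          rw [hammingDist_comm c' a]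
          exact_mod_cast hammingDist_triangle c a c'
      _ = 𝔼 c ∈ bucket H Ω a j, (hammingDist c a : ℝ) +
          𝔼 c' ∈ bucket H Ω a (j + 1), (hammingDist c' a : ℝ) := by
          simp_rw [Finset.expect_add_distrib, Finset.expect_const hne]
          rw [Finset.expect_const hne']
      _ ≤ _ := by
          have := expect_hammingDist_le_meanDist a hne
          have := expect_hammingDist_le_meanDist a hne'
          simp only [mul_zero, add_zero]
          linarith
  · rw [if_neg (by intro h; exact hne (by rwa [hb] at h)),
      if_pos (Finset.not_nonempty_iff_eq_empty.1 hne)]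
    have : (d : ℝ) / 2 ^ j * ξ = ξ * (d / 2 ^ j * 1) := by ring
    rw [this]
    linarith

/-- The last label is the identity, so the bucket contains at most `a` itself. -/
theorem meanDist_bucket_last (H : HashSeq d L) (Ω : Finset (Cube d)) (a : Cube d) :
    meanDist a (bucket H Ω a (L + 1)) = 0 := by
  rw [meanDist, Finset.sum_eq_zero, zero_div]
  intro c hc
  have h := (Finset.mem_filter.1 hc).2 L (by omega)
  have : c = a := by simpa [label] using h
  simp [this]

end Tree

/-! ### The random coordinates of the tree -/

section Coordinates

variable {d L : ℕ}

/-- The indices of the coordinates sampled for the first `j` levels. -/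
abbrev CoordIdx (j : ℕ) := Σ l : Fin j, Fin (2 ^ (l : ℕ))

theorem card_coordIdx (j : ℕ) : Fintype.card (CoordIdx j) = 2 ^ j - 1 := by
  rw [Fintype.card_sigma]
  simp only [Fintype.card_fin]
  rw [Fin.sum_univ_eq_sum_range (fun l => 2 ^ l), Nat.geomSum_eq le_rfl]
  simp

/-- The indices for the first `j` levels among those of the first `L` levels. -/
def coordEmb {j : ℕ} (hj : j ≤ L) : CoordIdx j → CoordIdx L :=
  fun p => ⟨Fin.castLE hj p.1, p.2⟩

theorem coordEmb_injective {j : ℕ} (hj : j ≤ L) :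
    Function.Injective (coordEmb hj) := by
  rintro ⟨⟨l, hl⟩, k⟩ ⟨⟨l', hl'⟩, k'⟩ h
  simp only [coordEmb, Sigma.mk.injEq, Fin.castLE_mk, Fin.mk.injEq] at h
  obtain ⟨rfl, h⟩ := h
  simpa using h

/-- All sampled coordinates as one function. -/
def coords (H : HashSeq d L) : CoordIdx L → Fin d := fun p => H p.1 p.2

theorem expect_coords (F : (CoordIdx L → Fin d) → ℝ) :
    𝔼 H : HashSeq d L, F (coords H) = 𝔼 g : CoordIdx L → Fin d, F g :=
  Fintype.expect_equiv
    (Equiv.piCurry (fun (l : Fin L) (_ : Fin (2 ^ (l : ℕ))) => Fin d)).symm _ _ fun _ => rfl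

/-- Isolates one sampled coordinate from any others: they are jointly uniform, so it can be averaged
independently of the rest. -/
theorem expect_coords_option (hd : 0 < d) {J : Type*} [Fintype J] [DecidableEq J]
    (e : Option J → CoordIdx L) (he : Function.Injective e) (F : Fin d → (J → Fin d) → ℝ) :
    𝔼 H : HashSeq d L, F (coords H (e none)) (fun k => coords H (e (some k))) =
      𝔼 i : Fin d, 𝔼 h : J → Fin d, F i h := by
  have : Nonempty (Fin d) := ⟨⟨0, hd⟩⟩
  rw [expect_coords (fun g => F (g (e none)) (fun k => g (e (some k))))]
  exact (expect_comp_injective e he (fun g => F (g none) (fun k => g (some k)))).trans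
    (expect_option_arrow (fun g : Option J → Fin d => F (g none) (fun k => g (some k))))

theorem label_eq_iff (H : HashSeq d L) {l : ℕ} (hl : l < L) (a c : Cube d) :
    label H l c = label H l a ↔
      ∀ k : Fin (2 ^ l), c (H ⟨l, hl⟩ k) = a (H ⟨l, hl⟩ k) := by
  rw [label, label, dif_pos hl, dif_pos hl, List.ofFn_inj, funext_iff]
  rfl

theorem bucket_eq_surv (H : HashSeq d L) (Ω : Finset (Cube d)) (a : Cube d) {j : ℕ} (hj : j ≤ L) :
    bucket H Ω a j = surv Ω a (coords H ∘ coordEmb hj) := by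
  unfold bucket surv
  congr 1
  ext c
  constructor
  · rintro h ⟨l, k⟩
    exact (label_eq_iff H (l.2.trans_le hj) a c).1 (h l l.2) k
  · intro h l hl
    exact (label_eq_iff H (hl.trans_le hj) a c).2 fun k => h ⟨⟨l, hl⟩, k⟩

theorem surv_option {J : Type*} [Fintype J] (Ω : Finset (Cube d)) (a : Cube d)
    (g : Option J → Fin d) :
    surv Ω a g = surv (Ω.filter fun c => c (g none) = a (g none)) a (fun k => g (some k)) := by
  ext c
  simp [surv, Option.forall, and_assoc]

/-- An enumeration of a finite type that starts with a given element. -/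
theorem exists_option_equiv {I : Type*} [Fintype I] [DecidableEq I] (i : I) {n : ℕ}
    (h : Fintype.card I = n + 1) : ∃ e : Option (Fin n) ≃ I, e none = i := by
  obtain ⟨e⟩ : Nonempty (Option (Fin n) ≃ I) := ⟨Fintype.equivOfCardEq (by simp [h])⟩
  exact ⟨e.trans (Equiv.swap (e none) i), by simp⟩

theorem ite_label_le (H : HashSeq d L) {l : ℕ} (hl : l < L) (a b : Cube d) :
    (if label H l a ≠ label H l b then (1 : ℝ) else 0) ≤
      ∑ k : Fin (2 ^ l), if a (H ⟨l, hl⟩ k) ≠ b (H ⟨l, hl⟩ k) then (1 : ℝ) else 0 := by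
  split_ifs with h
  · rw [ne_eq, label_eq_iff H hl] at h
    push Not at h
    obtain ⟨k, hk⟩ := h
    calc (1 : ℝ) = if a (H ⟨l, hl⟩ k) ≠ b (H ⟨l, hl⟩ k) then (1 : ℝ) else 0 := (if_pos hk).symm
      _ ≤ _ := Finset.single_le_sum
        (f := fun k => if a (H ⟨l, hl⟩ k) ≠ b (H ⟨l, hl⟩ k) then (1 : ℝ) else 0)
        (fun _ _ => by positivity) (Finset.mem_univ k)
  · exact Finset.sum_nonneg fun _ _ => by positivity

theorem expect_ite_ne_mul (a b : Cube d) (F : Fin d → ℝ) :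
    𝔼 i : Fin d, (if a i ≠ b i then (1 : ℝ) else 0) * F i =
      (∑ i with a i ≠ b i, F i) / d := by
  rw [Fintype.expect_eq_sum_div_card, Fintype.card_fin, Finset.sum_filter]
  simp only [ite_mul, one_mul, zero_mul]

/-- The contribution of a separation above the bucket. -/
theorem expect_label_mul_meanDist_le_of_lt (hd : 0 < d) (Ω : Finset (Cube d)) (a b : Cube d)
    {l j : ℕ} (hl : l < j) (hj : j ≤ L) :
    𝔼 H : HashSeq d L, (if label H l a ≠ label H l b then (1 : ℝ) else 0) *
        meanDist a (bucket H Ω a j) ≤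
      2 ^ l / d * ∑ i with a i ≠ b i,
        meanRad (Ω.filter fun c => c i = a i) a (Fin (2 ^ j - 2)) := by
  have hlL : l < L := hl.trans_le hj
  have hk : ∀ k : Fin (2 ^ l), 𝔼 H : HashSeq d L,
      (if a (H ⟨l, hlL⟩ k) ≠ b (H ⟨l, hlL⟩ k) then (1 : ℝ) else 0) *
        meanDist a (bucket H Ω a j) = (∑ i with a i ≠ b i,
        meanRad (Ω.filter fun c => c i = a i) a (Fin (2 ^ j - 2))) / d := by
    intro k
    have hcard : Fintype.card (CoordIdx j) = 2 ^ j - 2 + 1 := by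
      have : 2 ^ 1 ≤ 2 ^ j := Nat.pow_le_pow_right (by norm_num) (by omega)
      rw [card_coordIdx]; omega
    -- The separating coordinate is itself one of those that define the bucket. Once its value `i`
    -- is fixed, the bucket consists of the elements with `c i = a i` that survive the remaining `2
    -- ^ j - 2` independent coordinates.
    obtain ⟨e, he⟩ := exists_option_equiv (⟨⟨l, hl⟩, k⟩ : CoordIdx j) hcard
    rw [← expect_ite_ne_mul]
    have := expect_coords_option (L := L) hd (coordEmb hj ∘ e)
      ((coordEmb_injective hj).comp e.injective)
      (fun i h => (if a i ≠ b i then (1 : ℝ) else 0) *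
        meanDist a (surv (Ω.filter fun c => c i = a i) a h))
    simp_rw [← Finset.mul_expect] at this
    unfold meanRad
    rw [← this]
    refine Finset.expect_congr rfl fun H _ => ?_
    rw [bucket_eq_surv H Ω a hj, ← surv_comp_equiv Ω a e, surv_option]
    simp only [Function.comp_apply, he]
    rfl
  calc _ ≤ 𝔼 H : HashSeq d L, ∑ k : Fin (2 ^ l),
        (if a (H ⟨l, hlL⟩ k) ≠ b (H ⟨l, hlL⟩ k) then (1 : ℝ) else 0) *
        meanDist a (bucket H Ω a j) := by
        refine Finset.expect_le_expect fun H _ => ?_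
        rw [← Finset.sum_mul]
        exact mul_le_mul_of_nonneg_right (ite_label_le H hlL a b) (meanDist_nonneg _ _)
    _ = ∑ k : Fin (2 ^ l), (∑ i with a i ≠ b i,
        meanRad (Ω.filter fun c => c i = a i) a (Fin (2 ^ j - 2))) / d := by
        rw [Finset.expect_sum_comm]
        exact Finset.sum_congr rfl fun k _ => hk k
    _ = _ := by
        rw [Finset.sum_const, Finset.card_univ, Fintype.card_fin, nsmul_eq_mul]
        push_cast; ring

theorem expect_meanDist_bucket (hd : 0 < d) (Ω : Finset (Cube d)) (a : Cube d) {j : ℕ}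
    (hj : j ≤ L) :
    𝔼 H : HashSeq d L, meanDist a (bucket H Ω a j) = meanRad Ω a (Fin (2 ^ j - 1)) := by
  have : Nonempty (Fin d) := ⟨⟨0, hd⟩⟩
  simp_rw [bucket_eq_surv _ Ω a hj]
  rw [expect_coords (fun g => meanDist a (surv Ω a (g ∘ coordEmb hj))),
    expect_comp_injective (coordEmb hj) (coordEmb_injective hj)
      (fun g => meanDist a (surv Ω a g))]
  exact meanRad_congr Ω a (Fintype.equivFinOfCardEq (card_coordIdx j))

/-- The contribution of a separation at the bucket. -/
theorem expect_label_mul_meanDist_le_of_eq (hd : 0 < d) (hdL : (d : ℝ) ≤ 2 ^ L)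
    (Ω : Finset (Cube d)) {a b : Cube d} (hab : a ≠ b) {j : ℕ} (hj : j ≤ L) :
    𝔼 H : HashSeq d L, (if label H j a ≠ label H j b then (1 : ℝ) else 0) *
        meanDist a (bucket H Ω a j) ≤
      hammingDist a b * (2 ^ j / d * meanRad Ω a (Fin (2 ^ j - 1))) := by
  have hd' : (0 : ℝ) < d := by exact_mod_cast hd
  rcases hj.lt_or_eq with hjL | rfl
  · have hk : ∀ k : Fin (2 ^ j), 𝔼 H : HashSeq d L,
        (if a (H ⟨j, hjL⟩ k) ≠ b (H ⟨j, hjL⟩ k) then (1 : ℝ) else 0) *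
        meanDist a (bucket H Ω a j) =
        hammingDist a b / d * meanRad Ω a (Fin (2 ^ j - 1)) := by
      intro k
      -- Coordinates of level `j` do not enter the bucket at depth `j`, so separation and bucket are
      -- independent here.
      have hinj : Function.Injective
          (fun o : Option (CoordIdx j) => o.elim (⟨⟨j, hjL⟩, k⟩ : CoordIdx L) (coordEmb hj)) := by
        have hne : ∀ p : CoordIdx j, (⟨⟨j, hjL⟩, k⟩ : CoordIdx L) ≠ coordEmb hj p := by
          intro p hp
          have : j = p.1 := congrArg (fun q : CoordIdx L => (q.1 : ℕ)) hp
          exact absurd p.1.2 (by omega)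
        rintro (_ | p) (_ | q) h
        · rfl
        · exact absurd h (hne q)
        · exact absurd h.symm (hne p)
        · exact congrArg some (coordEmb_injective hj h)
      have := expect_coords_option (L := L) hd _ hinj
        (fun i h => (if a i ≠ b i then (1 : ℝ) else 0) * meanDist a (surv Ω a h))
      simp_rw [← Finset.mul_expect] at this
      rw [← meanRad_congr Ω a (Fintype.equivFinOfCardEq (card_coordIdx j)), ← expect_ne,
        Finset.expect_mul]
      unfold meanRad
      rw [← this]
      refine Finset.expect_congr rfl fun H _ => ?_
      rw [bucket_eq_surv H Ω a hj]
      rfl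
    calc _ ≤ 𝔼 H : HashSeq d L, ∑ k : Fin (2 ^ j),
          (if a (H ⟨j, hjL⟩ k) ≠ b (H ⟨j, hjL⟩ k) then (1 : ℝ) else 0) *
          meanDist a (bucket H Ω a j) := by
          refine Finset.expect_le_expect fun H _ => ?_
          rw [← Finset.sum_mul]
          exact mul_le_mul_of_nonneg_right (ite_label_le H hjL a b) (meanDist_nonneg _ _)
      _ = ∑ k : Fin (2 ^ j), hammingDist a b / d * meanRad Ω a (Fin (2 ^ j - 1)) := by
          rw [Finset.expect_sum_comm]
          exact Finset.sum_congr rfl fun k _ => hk k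
      _ = _ := by
          rw [Finset.sum_const, Finset.card_univ, Fintype.card_fin, nsmul_eq_mul]
          push_cast; ring
  -- At level `L` the label is the identity and separation is certain; `2 ^ L / d` and the distance
  -- are both at least `1`.
  · have hD : (1 : ℝ) ≤ hammingDist a b := by
      exact_mod_cast Nat.one_le_iff_ne_zero.2 (hammingDist_ne_zero.2 hab)
    calc _ ≤ 𝔼 H : HashSeq d j, meanDist a (bucket H Ω a j) := by
          refine Finset.expect_le_expect fun H _ => ?_
          exact mul_le_of_le_one_left (meanDist_nonneg _ _) (by split_ifs <;> norm_num)
      _ = meanRad Ω a (Fin (2 ^ j - 1)) := expect_meanDist_bucket hd Ω a le_rfl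
      _ ≤ _ := by
          rw [← mul_assoc]
          refine le_mul_of_one_le_left (meanRad_nonneg _ _) ?_
          have : 1 ≤ (2 : ℝ) ^ j / d := (one_le_div hd').2 hdL
          nlinarith

/-- The expected contribution of the mean distances to the distance of two leaves. -/
theorem sum_expect_label_mul_meanDist_le (hd : 0 < d) (hdL : (d : ℝ) ≤ 2 ^ L)
    (Ω : Finset (Cube d)) {a b : Cube d} (hab : a ≠ b) :
    ∑ j ∈ range (L + 1), ∑ l ∈ range (j + 1), 𝔼 H : HashSeq d L,
        (if label H l a ≠ label H l b then (1 : ℝ) else 0) * meanDist a (bucket H Ω a j) ≤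
      hammingDist a b * (6 + 4 * Real.log (1 + #Ω)) := by
  have hd' : (0 : ℝ) < d := by exact_mod_cast hd
  set R : Fin d → ℕ → ℝ :=
    fun i j => meanRad (Ω.filter fun c => c i = a i) a (Fin (2 ^ j - 2)) with hR
  have hR0 : ∀ i j, 0 ≤ R i j := fun i j => meanRad_nonneg _ _
  have hj : ∀ j ∈ range (L + 1), ∑ l ∈ range (j + 1), 𝔼 H : HashSeq d L,
        (if label H l a ≠ label H l b then (1 : ℝ) else 0) * meanDist a (bucket H Ω a j) ≤
      ∑ i with a i ≠ b i, 2 ^ j / d * R i j +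
        hammingDist a b * (2 ^ j / d * meanRad Ω a (Fin (2 ^ j - 1))) := by
    intro j hj
    have hjL : j ≤ L := by simpa [Nat.lt_succ_iff] using hj
    rw [Finset.sum_range_succ]
    refine add_le_add ?_ (expect_label_mul_meanDist_le_of_eq hd hdL Ω hab hjL)
    calc _ ≤ ∑ l ∈ range j, 2 ^ l / d * ∑ i with a i ≠ b i, R i j :=
          Finset.sum_le_sum fun l hl =>
            expect_label_mul_meanDist_le_of_lt hd Ω a b (Finset.mem_range.1 hl) hjL
      -- All earlier levels together sample fewer than `2 ^ j` coordinates, so the sum over `l`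
      -- costs only a geometric series.
      _ = (2 ^ j - 1) / d * ∑ i with a i ≠ b i, R i j := by
          rw [← Finset.sum_mul, ← Finset.sum_div, geom_sum_eq (by norm_num)]
          norm_num
      _ ≤ 2 ^ j / d * ∑ i with a i ≠ b i, R i j := by
          refine mul_le_mul_of_nonneg_right ?_ (Finset.sum_nonneg fun i _ => hR0 i j)
          gcongr
          linarith
      _ = _ := by rw [Finset.mul_sum]
  calc _ ≤ _ := Finset.sum_le_sum hj
    _ = ∑ i with a i ≠ b i, ∑ j ∈ range (L + 1), 2 ^ j / d * R i j +
        hammingDist a b * ∑ j ∈ range (L + 1), 2 ^ j / d * meanRad Ω a (Fin (2 ^ j - 1)) := by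
        rw [Finset.sum_add_distrib, Finset.sum_comm, Finset.mul_sum]
    _ ≤ ∑ i with a i ≠ b i, (3 + 2 * Real.log (1 + #Ω)) +
        hammingDist a b * (3 + 2 * Real.log (1 + #Ω)) := by
        refine add_le_add (Finset.sum_le_sum fun i _ => ?_)
          (mul_le_mul_of_nonneg_left (sum_meanRad_le hd Ω a (by norm_num) _) (by positivity))
        refine (sum_meanRad_le hd _ a le_rfl _).trans ?_
        have := Finset.card_le_card (Finset.filter_subset (fun c => c i = a i) Ω)
        gcongr
    _ = _ := by
        rw [Finset.sum_const, nsmul_eq_mul]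
        simp only [hammingDist]
        ring

end Coordinates

/-! ### Dyadic sums -/

section Dyadic

theorem sum_ite_two_pow_le {c B : ℝ} (hc : 0 ≤ c) (hB : 0 ≤ B) (n : ℕ) :
    ∑ j ∈ range n, (if c * 2 ^ j ≤ B then c * 2 ^ j else 0) ≤ 2 * B := by
  induction n with
  | zero => simpa using hB
  | succ n ih =>
    rw [Finset.sum_range_succ]
    split_ifs with h
    · have h1 : ∑ j ∈ range n, (if c * 2 ^ j ≤ B then c * 2 ^ j else 0) ≤
          ∑ j ∈ range n, c * 2 ^ j := Finset.sum_le_sum fun j _ => by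
        split_ifs
        · exact le_rfl
        · positivity
      rw [← Finset.mul_sum, geom_sum_eq (by norm_num)] at h1
      norm_num at h1
      nlinarith
    · linarith

theorem sum_ite_div_two_pow_le {c B : ℝ} (hc : 0 ≤ c) (hB : 0 ≤ B) (n : ℕ) :
    ∑ j ∈ range n, (if c / 2 ^ j ≤ B then c / 2 ^ j else 0) ≤ 2 * B := by
  -- The term `2 * min B (c / 2 ^ n)` reserves room for the whole remaining geometric tail.
  have main : ∑ j ∈ range n, (if c / 2 ^ j ≤ B then c / 2 ^ j else 0) +
      2 * min B (c / 2 ^ n) ≤ 2 * B := by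
    induction n with
    | zero => simp
    | succ n ih =>
      rw [Finset.sum_range_succ]
      have h2 : c / 2 ^ (n + 1) = c / 2 ^ n / 2 := by rw [pow_succ]; field_simp
      have h0 : 0 ≤ c / 2 ^ n := by positivity
      split_ifs with h
      · rw [min_eq_right h] at ih
        rw [min_eq_right (by rw [h2]; linarith), h2]
        linarith
      · rw [min_eq_left (not_le.1 h).le] at ih
        linarith [min_le_left B (c / 2 ^ (n + 1))]
  have : 0 ≤ min B (c / 2 ^ n) := le_min hB (by positivity)
  linarith

theorem card_dyadic_between_le {c u v : ℝ} (hc : 0 < c) (hu : 0 < u) (huv : u ≤ v) (n : ℕ) :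
    (∑ j ∈ range n, (if u < c * 2 ^ j ∧ c * 2 ^ j < v then (1 : ℝ) else 0)) * Real.log 2 ≤
      Real.log 2 + Real.log (v / u) := by
  have hl : 0 < Real.log 2 := Real.log_pos (by norm_num)
  have hlog : ∀ n : ℕ, Real.log (c * 2 ^ n / u) = Real.log (c / u) + n * Real.log 2 := fun n => by
    rw [mul_div_right_comm, Real.log_mul (by positivity) (by positivity), Real.log_pow]
  -- The first bound counts the powers passed since `u` and is what drives the induction; the second
  -- one stops growing beyond `v`.
  have main : (∑ j ∈ range n, (if u < c * 2 ^ j ∧ c * 2 ^ j < v then (1 : ℝ) else 0)) *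
        Real.log 2 ≤ max 0 (Real.log (c / u) + n * Real.log 2) ∧
      (∑ j ∈ range n, (if u < c * 2 ^ j ∧ c * 2 ^ j < v then (1 : ℝ) else 0)) * Real.log 2 ≤
      Real.log 2 + Real.log (v / u) := by
    induction n with
    | zero =>
      have : 0 ≤ Real.log (v / u) := Real.log_nonneg ((one_le_div hu).2 huv)
      simp only [range_zero, sum_empty, zero_mul]
      exact ⟨le_max_left _ _, by linarith⟩
    | succ n ih =>
      rw [Finset.sum_range_succ]
      have hmono : Real.log (c / u) + n * Real.log 2 ≤
          Real.log (c / u) + (n + 1 : ℕ) * Real.log 2 := by push_cast; linarith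
      split_ifs with h
      · have h1 : 0 ≤ Real.log (c * 2 ^ n / u) := Real.log_nonneg ((one_le_div hu).2 h.1.le)
        have h2 : Real.log (c * 2 ^ n / u) ≤ Real.log (v / u) :=
          Real.log_le_log (by positivity) (by gcongr; exact h.2.le)
        rw [hlog] at h1 h2
        rw [max_eq_right h1] at ih
        rw [add_mul, one_mul]
        refine ⟨le_max_of_le_right ?_, ?_⟩
        · push_cast; linarith [ih.1]
        · linarith [ih.1]
      · rw [add_zero]
        exact ⟨ih.1.trans (max_le_max le_rfl hmono), ih.2⟩
  exact main.2

/-- A dyadic sum whose terms decay on either side of a window of logarithmic length. -/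
theorem sum_div_two_pow_mul_le {d D A : ℝ} (hd : 0 < d) (hD : 0 < D) (hA : D ≤ A) (P : ℕ → ℝ)
    (n : ℕ) (h1 : ∀ j < n, P j ≤ 1) (h2 : ∀ j < n, P j ≤ 2 ^ (j + 1) * D / d)
    (h3 : ∀ j < n, P j ≤ (2 ^ (j + 1)) ^ 2 * (D * A) / d ^ 2) :
    ∑ j ∈ range n, d / 2 ^ j * P j ≤ 10 * D * (1 + Real.log (A / D)) := by
  have hA0 : 0 < A := hD.trans_le hA
  -- Three regimes: for `d / 2 ^ j ≥ 2 * A` the quadratic bound gives a geometric series, for `d / 2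
  -- ^ j ≤ 2 * D` the trivial bound does, and in the window between them the linear bound costs `2 *
  -- D` per scale.
  have hterm : ∀ j ∈ range n, d / 2 ^ j * P j ≤
      2 * (D * (if 2 * A / d * 2 ^ j ≤ 1 then 2 * A / d * 2 ^ j else 0) +
        (if d / 2 / 2 ^ j ≤ D then d / 2 / 2 ^ j else 0) +
        D * (if 1 / A < 2 / d * 2 ^ j ∧ 2 / d * 2 ^ j < 1 / D then 1 else 0)) := by
    intro j hj
    have hjn := Finset.mem_range.1 hj
    have hp : (0 : ℝ) < 2 ^ j := by positivity
    have t1 : 0 ≤ (if 2 * A / d * 2 ^ j ≤ 1 then 2 * A / d * 2 ^ j else 0) := by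
      split_ifs <;> positivity
    have t2 : 0 ≤ (if d / 2 / 2 ^ j ≤ D then d / 2 / 2 ^ j else 0) := by
      split_ifs <;> positivity
    have t3 : 0 ≤ (if 1 / A < 2 / d * 2 ^ j ∧ 2 / d * 2 ^ j < 1 / D then (1 : ℝ) else 0) := by
      split_ifs <;> norm_num
    have t1' := mul_nonneg hD.le t1
    have t3' := mul_nonneg hD.le t3
    have hdp : 0 ≤ d / 2 ^ j := by positivity
    by_cases c1 : 2 * A / d * 2 ^ j ≤ 1
    · have := mul_le_mul_of_nonneg_left (h3 j hjn) hdp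
      have e : d / 2 ^ j * ((2 ^ (j + 1)) ^ 2 * (D * A) / d ^ 2) =
          2 * (D * (2 * A / d * 2 ^ j)) := by rw [pow_succ]; field_simp; ring
      rw [if_pos c1]
      linarith
    · by_cases c2 : d / 2 / 2 ^ j ≤ D
      · have := mul_le_mul_of_nonneg_left (h1 j hjn) hdp
        have e : d / 2 ^ j * 1 = 2 * (d / 2 / 2 ^ j) := by field_simp
        rw [if_pos c2]
        linarith
      · have := mul_le_mul_of_nonneg_left (h2 j hjn) hdp
        have e : d / 2 ^ j * (2 ^ (j + 1) * D / d) = 2 * D := by rw [pow_succ]; field_simp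
        have c3 : 1 / A < 2 / d * 2 ^ j ∧ 2 / d * 2 ^ j < 1 / D := by
          constructor
          · rw [div_lt_iff₀ hA0]
            have := not_le.1 c1
            calc (1 : ℝ) < _ := this
              _ = _ := by ring
          · rw [lt_div_iff₀ hD]
            have := not_le.1 c2
            rw [div_div, lt_div_iff₀ (by positivity)] at this
            rw [div_mul_eq_mul_div, div_mul_eq_mul_div, div_lt_one hd]
            linarith
        rw [if_pos c3] at *
        linarith
  have hl : (1 : ℝ) / 2 < Real.log 2 := by linarith [Real.log_two_gt_d9]
  have g1 := sum_ite_two_pow_le (c := 2 * A / d) (B := 1) (by positivity) (by norm_num) n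
  have g2 := sum_ite_div_two_pow_le (c := d / 2) (B := D) (by positivity) hD.le n
  have g3 := card_dyadic_between_le (c := 2 / d) (u := 1 / A) (v := 1 / D) (by positivity)
    (by positivity) (by gcongr) n
  have e3 : 1 / D / (1 / A) = A / D := by field_simp
  rw [e3] at g3
  set N := ∑ j ∈ range n,
    (if 1 / A < 2 / d * 2 ^ j ∧ 2 / d * 2 ^ j < 1 / D then (1 : ℝ) else 0)
  have hlog : 0 ≤ Real.log (A / D) := Real.log_nonneg ((one_le_div hD).2 hA)
  have hN : N ≤ 1 + 2 * Real.log (A / D) := by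
    by_contra! hcon
    have h5 : (N - 1) * (1 / 2) ≤ (N - 1) * Real.log 2 :=
      mul_le_mul_of_nonneg_left hl.le (by linarith)
    linarith
  calc _ ≤ _ := Finset.sum_le_sum hterm
    _ = 2 * (D * ∑ j ∈ range n, (if 2 * A / d * 2 ^ j ≤ 1 then 2 * A / d * 2 ^ j else 0) +
        ∑ j ∈ range n, (if d / 2 / 2 ^ j ≤ D then d / 2 / 2 ^ j else 0) + D * N) := by
        rw [← Finset.mul_sum, Finset.sum_add_distrib, Finset.sum_add_distrib, Finset.mul_sum,
          Finset.mul_sum]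
    _ ≤ 2 * (D * (2 * 1) + 2 * D + D * (1 + 2 * Real.log (A / D))) := by gcongr
    _ ≤ _ := by nlinarith

end Dyadic

/-! ### Empty buckets -/

section Empty

variable {d L : ℕ}

theorem expect_coord (hd : 0 < d) (p : CoordIdx L) (f : Fin d → ℝ) :
    𝔼 H : HashSeq d L, f (coords H p) = 𝔼 i : Fin d, f i := by
  have : Nonempty (Fin d) := ⟨⟨0, hd⟩⟩
  rw [expect_coords (fun g => f (g p))]
  rw [← Fintype.expect_equiv (Equiv.funUnique Unit (Fin d)) (fun h => f (h ())) f fun _ => rfl]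
  exact expect_comp_injective (fun _ : Unit => p) (fun _ _ _ => rfl) (fun h => f (h ()))

theorem expect_coord_mul (hd : 0 < d) {p q : CoordIdx L} (hpq : p ≠ q) (f f' : Fin d → ℝ) :
    𝔼 H : HashSeq d L, f (coords H p) * f' (coords H q) =
      (𝔼 i : Fin d, f i) * 𝔼 i : Fin d, f' i := by
  have hinj : Function.Injective (fun o : Option Unit => o.elim p fun _ => q) := by
    rintro (_ | _) (_ | _) h
    · rfl
    · exact absurd h hpq
    · exact absurd h.symm hpq
    · rfl
  refine (expect_coords_option hd _ hinj (fun i h => f i * f' (h ()))).trans ?_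
  simp_rw [← Finset.mul_expect]
  rw [← Finset.expect_mul]
  congr 1
  exact Fintype.expect_equiv (Equiv.funUnique Unit (Fin d)) _ _ fun _ => rfl

theorem expect_boole_mem (U : Finset (Fin d)) :
    𝔼 i : Fin d, (if i ∈ U then (1 : ℝ) else 0) = #U / d := by
  rw [Fintype.expect_eq_sum_div_card, Fintype.card_fin]
  simp

theorem Separated.exists_coord {H : HashSeq d L} {a b : Cube d} {j : ℕ} (hj : j + 1 ≤ L)
    (h : Separated H a b j) :
    ∃ p : CoordIdx (j + 1), a (coords H (coordEmb hj p)) ≠ b (coords H (coordEmb hj p)) := by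
  obtain ⟨l, hl, hne⟩ := h
  rw [ne_eq, label_eq_iff H (by omega : l < L)] at hne
  push Not at hne
  obtain ⟨k, hk⟩ := hne
  exact ⟨⟨⟨l, by omega⟩, k⟩, hk⟩

/-- If two elements `a`, `b` are separated and the bucket of `e` contains no neighbor of `z`, then
two different coordinates were sampled among those where `a`, `b`, `z` do not all agree. -/
theorem exists_second_coord {H : HashSeq d L} {Ω : Finset (Cube d)} {e z : Cube d}
    (hz : z ∈ Ω) {j : ℕ} (hj : j ≤ L) {U : Finset (Fin d)}
    (hU : ∀ i, i ∉ U → e i = z i) (hempty : bucket H (nbr Ω) e j = ∅) (p : CoordIdx j) :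
    ∃ q : CoordIdx j, q ≠ p ∧ coords H (coordEmb hj q) ∈ U := by
  by_contra! hcon
  set i := coords H (coordEmb hj p) with hi
  -- If only `p` hits `U`, changing `z` at that single coordinate produces a neighbor of the sample
  -- that agrees with `e` on every sampled coordinate, so the bucket is not empty.
  have hmem : Function.update z i (e i) ∈ bucket H (nbr Ω) e j := by
    rw [bucket_eq_surv H _ e hj, surv, Finset.mem_filter]
    refine ⟨?_, fun q => ?_⟩
    · refine Finset.mem_filter.2 ⟨Finset.mem_univ _, z, hz, ?_⟩
      unfold hammingDist
      refine Finset.card_le_one.2 fun x hx y hy => ?_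
      have hone : ∀ x, z x ≠ Function.update z i (e i) x → x = i := fun x hx => by
        by_contra hne
        exact hx (by rw [Function.update_of_ne hne])
      rw [hone x (Finset.mem_filter.1 hx).2, hone y (Finset.mem_filter.1 hy).2]
    · simp only [Function.comp_apply]
      by_cases hq : coords H (coordEmb hj q) = i
      · rw [hq, Function.update_self]
      · rw [Function.update_of_ne hq]
        refine (hU _ (hcon q fun h => hq ?_)).symm
        rw [h, hi]
  rw [hempty] at hmem
  exact absurd hmem (Finset.notMem_empty _)

open scoped Classical in
-- With `r` the distance from `a` to `z`, the event has probability at most a union bound over one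
-- coordinate hitting the `D` positions where `a` and `b` differ. It is also bounded over pairs, the
-- second coordinate hitting one of at most `r + D` positions. The dyadic sum is then taken with `A
-- = r + D`.
theorem sum_expect_separated_empty_le (hd : 0 < d) (hdL : (d : ℝ) ≤ 2 ^ L)
    {Ω : Finset (Cube d)} {a b z : Cube d} (hab : a ≠ b) (hz : z ∈ Ω) {e : Cube d}
    (he : e = a ∨ e = b) :
    ∑ j ∈ range (L + 1), (d : ℝ) / 2 ^ j * 𝔼 H : HashSeq d L,
        (if Separated H a b j ∧ bucket H (nbr Ω) e (j + 1) = ∅ then (1 : ℝ) else 0) ≤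
      11 * hammingDist a b * (1 + Real.log (1 + hammingDist a z / hammingDist a b)) := by
  have : Nonempty (Fin d) := ⟨⟨0, hd⟩⟩
  have hd' : (0 : ℝ) < d := by exact_mod_cast hd
  have hD1 : (1 : ℝ) ≤ hammingDist a b := by
    exact_mod_cast Nat.one_le_iff_ne_zero.2 (hammingDist_ne_zero.2 hab)
  set D : ℝ := (hammingDist a b : ℝ) with hDdef
  set r : ℝ := (hammingDist a z : ℝ) with hr
  have hr0 : 0 ≤ r := by positivity
  set P : ℕ → ℝ := fun j => 𝔼 H : HashSeq d L,
    (if Separated H a b j ∧ bucket H (nbr Ω) e (j + 1) = ∅ then (1 : ℝ) else 0) with hP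
  have hP1 : ∀ j, P j ≤ 1 := fun j =>
    Finset.expect_le Finset.univ_nonempty fun H _ => by split_ifs <;> norm_num
  set V : Finset (Fin d) := univ.filter fun i => a i ≠ b i with hV
  set U : Finset (Fin d) := univ.filter fun i => a i ≠ b i ∨ a i ≠ z i with hUdef
  have hVc : (#V : ℝ) = D := rfl
  have hUc : (#U : ℝ) ≤ r + D := by
    have : #U ≤ hammingDist a b + hammingDist a z := by
      rw [hUdef, Finset.filter_or]
      exact Finset.card_union_le _ _
    have : (#U : ℝ) ≤ hammingDist a b + hammingDist a z := by exact_mod_cast this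
    linarith
  have hUe : ∀ i, i ∉ U → e i = z i := fun i hi => by
    simp only [hUdef, Finset.mem_filter, Finset.mem_univ, true_and, not_or, not_not] at hi
    rcases he with rfl | rfl
    · exact hi.2
    · rw [← hi.1, hi.2]
  have hcard : ∀ j, (Fintype.card (CoordIdx j) : ℝ) ≤ 2 ^ j := fun j => by
    rw [card_coordIdx]
    exact_mod_cast Nat.sub_le _ _
  have hP2 : ∀ j < L, P j ≤ 2 ^ (j + 1) * D / d := by
    intro j hj
    calc P j ≤ 𝔼 H : HashSeq d L, ∑ p : CoordIdx (j + 1),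
          (if coords H (coordEmb hj p) ∈ V then (1 : ℝ) else 0) := by
          refine Finset.expect_le_expect fun H _ => ?_
          split_ifs with h
          · obtain ⟨p, hp⟩ := h.1.exists_coord hj
            calc (1 : ℝ) = if coords H (coordEmb hj p) ∈ V then (1 : ℝ) else 0 :=
                  (if_pos (by simpa [hV] using hp)).symm
              _ ≤ _ := Finset.single_le_sum
                (f := fun p => if coords H (coordEmb hj p) ∈ V then (1 : ℝ) else 0)
                (fun _ _ => by positivity) (Finset.mem_univ p)
          · exact Finset.sum_nonneg fun _ _ => by positivity
      _ = Fintype.card (CoordIdx (j + 1)) * (D / d) := by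
          rw [Finset.expect_sum_comm]
          simp_rw [expect_coord hd _ (fun i => if i ∈ V then (1 : ℝ) else 0), expect_boole_mem]
          simp [hVc]
      _ ≤ 2 ^ (j + 1) * (D / d) := by gcongr; exact hcard _
      _ = _ := by ring
  have hP3 : ∀ j < L, P j ≤ (2 ^ (j + 1)) ^ 2 * (D * (r + D)) / d ^ 2 := by
    intro j hj
    calc P j ≤ 𝔼 H : HashSeq d L, ∑ p : CoordIdx (j + 1), ∑ q with q ≠ p,
          (if coords H (coordEmb hj p) ∈ V then (1 : ℝ) else 0) *
          (if coords H (coordEmb hj q) ∈ U then (1 : ℝ) else 0) := by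
          refine Finset.expect_le_expect fun H _ => ?_
          have hnn : ∀ p q : CoordIdx (j + 1),
              0 ≤ (if coords H (coordEmb hj p) ∈ V then (1 : ℝ) else 0) *
                (if coords H (coordEmb hj q) ∈ U then (1 : ℝ) else 0) := fun p q => by positivity
          split_ifs with h
          · obtain ⟨p, hp⟩ := h.1.exists_coord hj
            obtain ⟨q, hqp, hq⟩ := exists_second_coord hz hj hUe h.2 p
            calc (1 : ℝ) = (if coords H (coordEmb hj p) ∈ V then (1 : ℝ) else 0) *
                  (if coords H (coordEmb hj q) ∈ U then (1 : ℝ) else 0) := by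
                  rw [if_pos (by simpa [hV] using hp), if_pos hq, one_mul]
              _ ≤ ∑ q with q ≠ p, (if coords H (coordEmb hj p) ∈ V then (1 : ℝ) else 0) *
                  (if coords H (coordEmb hj q) ∈ U then (1 : ℝ) else 0) :=
                Finset.single_le_sum (f := fun q => (if coords H (coordEmb hj p) ∈ V then (1 : ℝ)
                  else 0) * (if coords H (coordEmb hj q) ∈ U then (1 : ℝ) else 0))
                  (fun q _ => hnn p q) (by simpa using hqp)
              _ ≤ _ := Finset.single_le_sum (f := fun p => ∑ q with q ≠ p,
                  (if coords H (coordEmb hj p) ∈ V then (1 : ℝ) else 0) *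
                  (if coords H (coordEmb hj q) ∈ U then (1 : ℝ) else 0))
                  (fun p _ => Finset.sum_nonneg fun q _ => hnn p q) (Finset.mem_univ p)
          · exact Finset.sum_nonneg fun p _ => Finset.sum_nonneg fun q _ => hnn p q
      -- Different indices `p ≠ q` carry independent coordinates, so the probabilities multiply.
      _ = ∑ p : CoordIdx (j + 1), ∑ q with q ≠ p, D / d * (#U / d) := by
          rw [Finset.expect_sum_comm]
          refine Finset.sum_congr rfl fun p _ => ?_
          rw [Finset.expect_sum_comm]
          refine Finset.sum_congr rfl fun q hq => ?_
          rw [expect_coord_mul hd (fun h => (Finset.mem_filter.1 hq).2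
            (coordEmb_injective hj h).symm) (fun i => if i ∈ V then (1 : ℝ) else 0)
            (fun i => if i ∈ U then (1 : ℝ) else 0), expect_boole_mem, expect_boole_mem, hVc]
      _ ≤ ∑ p : CoordIdx (j + 1), ∑ q : CoordIdx (j + 1), D / d * (#U / d) := by
          refine Finset.sum_le_sum fun p _ => ?_
          exact Finset.sum_le_sum_of_subset_of_nonneg (Finset.filter_subset _ _)
            fun _ _ _ => by positivity
      _ = Fintype.card (CoordIdx (j + 1)) * (Fintype.card (CoordIdx (j + 1)) *
          (D / d * (#U / d))) := by
          simp only [Finset.sum_const, Finset.card_univ, nsmul_eq_mul]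
      _ ≤ 2 ^ (j + 1) * (2 ^ (j + 1) * (D / d * ((r + D) / d))) := by
          have := hcard (j + 1)
          gcongr
      _ = _ := by field_simp
  have hsum := sum_div_two_pow_mul_le hd' (by linarith : 0 < D) (by linarith : D ≤ r + D) P L
    (fun j _ => hP1 j) hP2 hP3
  have hlog : Real.log ((r + D) / D) = Real.log (1 + r / D) := by
    congr 1
    field_simp
    ring
  rw [hlog] at hsum
  have hlog0 : 0 ≤ Real.log (1 + r / D) :=
    Real.log_nonneg (by have : 0 ≤ r / D := by positivity
                        linarith)
  rw [Finset.sum_range_succ]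
  -- The identity level lies outside the coordinate argument, but its scale `d / 2 ^ L` is at most
  -- `1 ≤ D`.
  have hlast : (d : ℝ) / 2 ^ L * P L ≤ D := by
    have h1 : (d : ℝ) / 2 ^ L ≤ 1 := (div_le_one (by positivity)).2 hdL
    calc (d : ℝ) / 2 ^ L * P L ≤ d / 2 ^ L * 1 := by gcongr; exact hP1 L
      _ ≤ D := by linarith
  nlinarith

end Empty

/-! ### The expected tree distance for a fixed sample -/

section FixedSample

variable {s d L : ℕ}

open scoped Classical in
-- Combines the three parts of `pathWeight_le`: the buckets at the upper and lower ends of the edges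
-- are both controlled by the sum of the `G j`, and the default weights by the empty-bucket
-- estimate.
theorem sum_expect_separated_mul_pathWeight_le (hd : 0 < d) (hdL : (d : ℝ) ≤ 2 ^ L)
    {Ω : Finset (Cube d)} {ξ : ℝ} (hξ : 0 ≤ ξ) {a b z : Cube d} (hab : a ≠ b) (hz : z ∈ Ω)
    {e : Cube d} (he : e = a ∨ e = b) :
    ∑ j ∈ range (L + 1), 𝔼 H : HashSeq d L,
        (if Separated H a b j then (1 : ℝ) else 0) * pathWeight H (nbr Ω) ξ e j ≤
      hammingDist a b * (24 + 16 * Real.log (1 + #(nbr Ω)) +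
        11 * ξ * (1 + Real.log (1 + hammingDist a z / hammingDist a b))) := by
  set M : ℕ → HashSeq d L → ℝ := fun j H => meanDist e (bucket H (nbr Ω) e j) with hM
  have hM0 : ∀ j H, 0 ≤ M j H := fun j H => meanDist_nonneg _ _
  set G : ℕ → ℝ := fun j => ∑ l ∈ range (j + 1), 𝔼 H : HashSeq d L,
    (if label H l a ≠ label H l b then (1 : ℝ) else 0) * M j H with hG
  have hG0 : ∀ j, 0 ≤ G j := fun j => Finset.sum_nonneg fun l _ =>
    Finset.expect_nonneg fun H _ => mul_nonneg (by positivity) (hM0 j H)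
  have hGsum : ∑ j ∈ range (L + 1), G j ≤
      hammingDist a b * (6 + 4 * Real.log (1 + #(nbr Ω))) := by
    rcases he with rfl | rfl
    · exact sum_expect_label_mul_meanDist_le hd hdL (nbr Ω) hab
    · have := sum_expect_label_mul_meanDist_le hd hdL (nbr Ω) hab.symm
      simp only [ne_comm, hammingDist_comm e a] at this
      simpa only [hG, hM, ne_comm] using this
  have hsep : ∀ i j, i ≤ j → 𝔼 H : HashSeq d L,
      (if Separated H a b i then (1 : ℝ) else 0) * M j H ≤ G j := by
    intro i j hij
    simp only [hG]
    rw [← Finset.expect_sum_comm]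
    refine Finset.expect_le_expect fun H _ => ?_
    rw [← Finset.sum_mul]
    refine mul_le_mul_of_nonneg_right ?_ (hM0 j H)
    split_ifs with h
    · obtain ⟨l, hl, hne⟩ := h
      calc (1 : ℝ) = if label H l a ≠ label H l b then (1 : ℝ) else 0 := (if_pos hne).symm
        _ ≤ _ := Finset.single_le_sum
          (f := fun l => if label H l a ≠ label H l b then (1 : ℝ) else 0)
          (fun _ _ => by positivity) (Finset.mem_range.2 (by omega))
    · exact Finset.sum_nonneg fun _ _ => by positivity
  -- The lower bucket at depth `j + 1` is charged to `G (j + 1)`; at depth `L + 1` it has mean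
  -- distance `0`, so the shifted sum stays in range.
  have hshift : ∑ j ∈ range (L + 1), 𝔼 H : HashSeq d L,
      (if Separated H a b j then (1 : ℝ) else 0) * M (j + 1) H ≤ ∑ j ∈ range (L + 1), G j := by
    rw [Finset.sum_range_succ, Finset.sum_range_succ' G]
    refine add_le_add (Finset.sum_le_sum fun j _ => hsep j (j + 1) (by omega)) ?_
    simp only [hM, meanDist_bucket_last, mul_zero]
    rw [Finset.expect_const_zero]
    exact hG0 0
  have hE := sum_expect_separated_empty_le (Ω := Ω) hd hdL hab hz he
  calc _ ≤ ∑ j ∈ range (L + 1), (2 * 𝔼 H : HashSeq d L,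
          (if Separated H a b j then (1 : ℝ) else 0) * M j H +
        2 * 𝔼 H : HashSeq d L, (if Separated H a b j then (1 : ℝ) else 0) * M (j + 1) H +
        ξ * ((d : ℝ) / 2 ^ j * 𝔼 H : HashSeq d L,
        (if Separated H a b j ∧ bucket H (nbr Ω) e (j + 1) = ∅ then (1 : ℝ) else 0))) := by
        refine Finset.sum_le_sum fun j hj => ?_
        simp only [Finset.mul_expect, ← Finset.expect_add_distrib]
        refine Finset.expect_le_expect fun H _ => ?_
        have := pathWeight_le H (nbr Ω) ξ e (Nat.lt_succ_iff.1 (Finset.mem_range.1 hj))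
        by_cases hs : Separated H a b j
        · simpa [hs] using this
        · simp [hs]
    _ = 2 * ∑ j ∈ range (L + 1), 𝔼 H : HashSeq d L,
          (if Separated H a b j then (1 : ℝ) else 0) * M j H +
        2 * ∑ j ∈ range (L + 1), 𝔼 H : HashSeq d L,
          (if Separated H a b j then (1 : ℝ) else 0) * M (j + 1) H +
        ξ * ∑ j ∈ range (L + 1), (d : ℝ) / 2 ^ j * 𝔼 H : HashSeq d L,
        (if Separated H a b j ∧ bucket H (nbr Ω) e (j + 1) = ∅ then (1 : ℝ) else 0) := by
        rw [Finset.sum_add_distrib, Finset.sum_add_distrib, Finset.mul_sum, Finset.mul_sum,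
          Finset.mul_sum]
    _ ≤ 2 * ∑ j ∈ range (L + 1), G j + 2 * ∑ j ∈ range (L + 1), G j +
        ξ * (11 * hammingDist a b *
          (1 + Real.log (1 + hammingDist a z / hammingDist a b))) := by
        have := Finset.sum_le_sum fun j (_ : j ∈ range (L + 1)) => hsep j j le_rfl
        gcongr
    _ ≤ _ := by linarith

/-- The expected distance of two leaves, with `z` an arbitrary element of the sample. -/
theorem expect_treeDist_le (hd : 0 < d) (hdL : (d : ℝ) ≤ 2 ^ L)
    {Ω : Finset (Cube d)} {ξ : ℝ} (hξ : 0 ≤ ξ) (a b : Cube d) {z : Cube d} (hz : z ∈ Ω) :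
    𝔼 H : HashSeq d L, treeDist H (nbr Ω) ξ (leaf H a) (leaf H b) ≤
      hammingDist a b * (48 + 32 * Real.log (1 + #(nbr Ω)) +
        22 * ξ * (1 + Real.log (1 + hammingDist a z / hammingDist a b))) := by
  classical
  have : Nonempty (Fin d) := ⟨⟨0, hd⟩⟩
  have h0 := Finset.expect_le_expect fun (H : HashSeq d L) (_ : H ∈ univ) =>
    treeDist_leaf_le H (nbr Ω) hξ a b
  by_cases hab : a = b
  · subst hab
    refine h0.trans_eq ?_
    simp [Separated]
  refine h0.trans ?_
  rw [Finset.expect_sum_comm]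
  have ha := sum_expect_separated_mul_pathWeight_le hd hdL hξ hab hz (Or.inl rfl)
  have hb := sum_expect_separated_mul_pathWeight_le hd hdL hξ hab hz (Or.inr rfl)
  calc _ = ∑ j ∈ range (L + 1), 𝔼 H : HashSeq d L,
        (if Separated H a b j then (1 : ℝ) else 0) * pathWeight H (nbr Ω) ξ a j +
      ∑ j ∈ range (L + 1), 𝔼 H : HashSeq d L,
        (if Separated H a b j then (1 : ℝ) else 0) * pathWeight H (nbr Ω) ξ b j := by
        rw [← Finset.sum_add_distrib]
        refine Finset.sum_congr rfl fun j _ => ?_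
        rw [← Finset.expect_add_distrib]
        refine Finset.expect_congr rfl fun H _ => ?_
        rw [← mul_add, ite_mul, one_mul, zero_mul]
    _ ≤ _ := add_le_add ha hb
    _ = _ := by ring

theorem card_nbr_le (Ω : Finset (Cube d)) : #(nbr Ω) ≤ #Ω * (d + 1) := by
  have hsub : nbr Ω ⊆ (Ω ×ˢ (univ : Finset (Option (Fin d)))).image fun q =>
      q.2.elim q.1 fun i => Function.update q.1 i (!q.1 i) := by
    intro b' hb'
    obtain ⟨b, hb, hdist⟩ := (Finset.mem_filter.1 hb').2
    rw [Finset.mem_image]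
    by_cases heq : b = b'
    · exact ⟨(b, none), by simp [hb], heq⟩
    · obtain ⟨i, hi⟩ := Function.ne_iff.1 heq
      refine ⟨(b, some i), by simp [hb], funext fun k => ?_⟩
      have hone := Finset.card_le_one.1 hdist
      simp only [Option.elim]
      by_cases hk : k = i
      · subst hk
        rw [Function.update_self]
        revert hi
        cases b k <;> cases b' k <;> simp
      · rw [Function.update_of_ne hk]
        by_contra hne
        exact hk (hone k (by simpa using hne) i (by simpa using hi))
  calc #(nbr Ω) ≤ _ := Finset.card_le_card hsub
    _ ≤ _ := Finset.card_image_le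
    _ = _ := by simp

theorem card_sampleSet_le {m : ℕ} (Y : Fin m → Point s d) : #(sampleSet Y) ≤ m * s := by
  have hsub : sampleSet Y ⊆ (univ : Finset (Fin m × Fin s)).image fun q => Y q.1 q.2 := by
    intro b hb
    obtain ⟨i, j, h⟩ := (Finset.mem_filter.1 hb).2
    exact Finset.mem_image.2 ⟨(i, j), Finset.mem_univ _, h⟩
  calc _ ≤ _ := Finset.card_le_card hsub
    _ ≤ _ := Finset.card_image_le
    _ = _ := by simp

/-- The distance of `a` to the set `Ω`. -/
noncomputable def distTo (a : Cube d) (Ω : Finset (Cube d)) : ℕ :=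
  sInf ((fun c => hammingDist a c) '' (Ω : Set (Cube d)))

theorem exists_distTo (a : Cube d) {Ω : Finset (Cube d)} (hΩ : Ω.Nonempty) :
    ∃ z ∈ Ω, hammingDist a z = distTo a Ω :=
  Nat.sInf_mem (s := (fun c => hammingDist a c) '' (Ω : Set (Cube d)))
    (Set.Nonempty.image _ hΩ)

theorem distTo_le (a : Cube d) {Ω : Finset (Cube d)} {c : Cube d} (hc : c ∈ Ω) :
    distTo a Ω ≤ hammingDist a c :=
  Nat.sInf_le ⟨c, hc, rfl⟩

theorem sampleSet_nonempty {m : ℕ} (hm : 0 < m) (hs : 0 < s) (Y : Fin m → Point s d) :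
    (sampleSet Y).Nonempty :=
  ⟨Y ⟨0, hm⟩ ⟨0, hs⟩, Finset.mem_filter.2 ⟨Finset.mem_univ _, _, _, rfl⟩⟩

/-- Any fixed matching bounds the minimum. For each pair, `z` is chosen as a sampled element nearest
to `x i`. -/
theorem expect_treeEMD_le (hd : 0 < d) (hdL : (d : ℝ) ≤ 2 ^ L) {ξ : ℝ} (hξ : 0 ≤ ξ) {m : ℕ}
    (hm : 0 < m) (hs : 0 < s) (Y : Fin m → Point s d) (x y : Point s d)
    (π : Equiv.Perm (Fin s)) :
    𝔼 H : HashSeq d L, treeEMD H (nbr (sampleSet Y)) ξ x y ≤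
      ∑ i, hammingDist (x i) (y (π i)) * (48 + 32 * Real.log (1 + m * s * (d + 1)) +
        22 * ξ * (1 + Real.log (1 + distTo (x i) (sampleSet Y) /
          hammingDist (x i) (y (π i))))) := by
  calc _ ≤ 𝔼 H : HashSeq d L, ∑ i, treeDist H (nbr (sampleSet Y)) ξ (leaf H (x i))
        (leaf H (y (π i))) := Finset.expect_le_expect fun H _ =>
        ciInf_le (Set.finite_range _).bddBelow π
    _ = ∑ i, 𝔼 H : HashSeq d L, treeDist H (nbr (sampleSet Y)) ξ (leaf H (x i))
        (leaf H (y (π i))) := Finset.expect_sum_comm _ _ _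
    _ ≤ _ := by
        refine Finset.sum_le_sum fun i _ => ?_
        obtain ⟨z, hz, hdist⟩ := exists_distTo (x i) (sampleSet_nonempty hm hs Y)
        refine (expect_treeDist_le hd hdL hξ (x i) (y (π i)) hz).trans ?_
        rw [hdist]
        have h1 : #(nbr (sampleSet Y)) ≤ m * s * (d + 1) :=
          (card_nbr_le _).trans (Nat.mul_le_mul_right _ (card_sampleSet_le Y))
        have h2 : (#(nbr (sampleSet Y)) : ℝ) ≤ m * s * (d + 1) := by exact_mod_cast h1
        gcongr

end FixedSample

/-! ### Locally dense points are close to the sample -/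

section Density

variable {s d L m : ℕ}

/-- The expectation of `F` over `m` independent samples from `μ`. -/
noncomputable def sampleMean (μ : PMF (Point s d)) (m : ℕ) (F : (Fin m → Point s d) → ℝ) : ℝ :=
  ∑ Y : Fin m → Point s d, (∏ i, (μ (Y i)).toReal) * F Y

theorem sum_pmf_toReal {α : Type*} [Fintype α] (μ : PMF α) : ∑ u, (μ u).toReal = 1 := by
  rw [← ENNReal.toReal_sum fun u _ => μ.apply_ne_top u, ← tsum_fintype (L := SummationFilter.unconditional α),
    μ.tsum_coe,
    ENNReal.toReal_one]

theorem sampleMean_prod (μ : PMF (Point s d)) (m : ℕ) (f : Point s d → ℝ) :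
    sampleMean μ m (fun Y => ∏ i, f (Y i)) = (∑ u, (μ u).toReal * f u) ^ m := by
  unfold sampleMean
  simp_rw [← Finset.prod_mul_distrib]
  exact (Fintype.sum_pow (fun u => (μ u).toReal * f u) m).symm

theorem sampleMean_mono (μ : PMF (Point s d)) {F G : (Fin m → Point s d) → ℝ}
    (h : ∀ Y, F Y ≤ G Y) : sampleMean μ m F ≤ sampleMean μ m G :=
  Finset.sum_le_sum fun Y _ => mul_le_mul_of_nonneg_left (h Y)
    (Finset.prod_nonneg fun _ _ => ENNReal.toReal_nonneg)

theorem sampleMean_const (μ : PMF (Point s d)) (m : ℕ) (c : ℝ) :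
    sampleMean μ m (fun _ => c) = c := by
  have h := sampleMean_prod μ m (fun _ => 1)
  simp only [Finset.prod_const_one, mul_one, sum_pmf_toReal, one_pow] at h
  unfold sampleMean at *
  rw [← Finset.sum_mul]
  simp only [mul_one] at h
  rw [h, one_mul]

theorem sampleMean_add (μ : PMF (Point s d)) (F G : (Fin m → Point s d) → ℝ) :
    sampleMean μ m (fun Y => F Y + G Y) = sampleMean μ m F + sampleMean μ m G := by
  unfold sampleMean
  rw [← Finset.sum_add_distrib]
  exact Finset.sum_congr rfl fun _ _ => by ring

theorem sampleMean_const_mul (μ : PMF (Point s d)) (c : ℝ) (F : (Fin m → Point s d) → ℝ) :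
    sampleMean μ m (fun Y => c * F Y) = c * sampleMean μ m F := by
  unfold sampleMean
  rw [Finset.mul_sum]
  exact Finset.sum_congr rfl fun _ _ => by ring

theorem sampleMean_sum {ι : Type*} (μ : PMF (Point s d)) (S : Finset ι)
    (F : ι → (Fin m → Point s d) → ℝ) :
    sampleMean μ m (fun Y => ∑ i ∈ S, F i Y) = ∑ i ∈ S, sampleMean μ m (F i) := by
  unfold sampleMean
  rw [Finset.sum_comm]
  exact Finset.sum_congr rfl fun _ _ => Finset.mul_sum _ _ _

/-- The number of hash coordinates on which two points differ is at least the number of elements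
of one of them whose buckets contain no element of the other. -/
theorem card_le_card_chi_ne {t : ℕ} (i : Fin t → Fin d) (x u : Point s d) (B : Finset (Fin s))
    (hB : ∀ j ∈ B, ∀ k, proj i (x j) ≠ proj i (u k)) :
    #B ≤ #(univ.filter fun q : (Fin t → Bool) × Fin s => chi i x q.1 q.2 ≠ chi i u q.1 q.2) := by
  classical
  set Q := univ.filter fun q : (Fin t → Bool) × Fin s => chi i x q.1 q.2 ≠ chi i u q.1 q.2 with hQ
  rw [Finset.card_eq_sum_card_fiberwise (f := fun j => proj i (x j)) (t := univ)
      (fun _ _ => Finset.mem_coe.2 (Finset.mem_univ _)),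
    Finset.card_eq_sum_card_fiberwise (s := Q) (f := Prod.fst) (t := univ)
      (fun _ _ => Finset.mem_coe.2 (Finset.mem_univ _))]
  -- Compare within one bucket `v`. If it contains an element indexed by `B`, it contains none of
  -- `u`, so `chi` differs for every threshold up to the number `N` of elements of `x` in it.
  refine Finset.sum_le_sum fun v _ => ?_
  rcases (B.filter fun j => proj i (x j) = v).eq_empty_or_nonempty with hemp | ⟨j₀, hj₀⟩
  · simp [hemp]
  have hj₀' := Finset.mem_filter.1 hj₀
  have hu : (univ.filter fun k => proj i (u k) = v) = ∅ := by
    rw [Finset.filter_eq_empty_iff]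
    intro k _ hk
    exact hB j₀ hj₀'.1 k (hj₀'.2.trans hk.symm)
  set N := #(univ.filter fun j => proj i (x j) = v) with hN
  have hNs : N ≤ s := by simpa using Finset.card_le_univ (univ.filter fun j => proj i (x j) = v)
  calc #(B.filter fun j => proj i (x j) = v) ≤ N :=
        Finset.card_le_card (Finset.filter_subset_filter _ (Finset.subset_univ _))
    _ = #(univ : Finset (Fin N)) := by simp
    _ ≤ _ := by
      refine Finset.card_le_card_of_injOn (fun k => (v, Fin.castLE hNs k)) (fun k _ => ?_) ?_
      · simp only [Finset.coe_filter, hQ, Set.mem_ofPred_eq, Finset.mem_filter, Finset.mem_univ,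
          true_and, and_true]
        unfold chi
        rw [hu, ← hN]
        simp
      · intro k _ k' _ h
        simpa using h

theorem bernoulliWeight_nonneg {p : ℝ} (h0 : 0 ≤ p) (h1 : p ≤ 1) (c : Bool) :
    0 ≤ bernoulliWeight p c := by
  unfold bernoulliWeight
  split_ifs <;> linarith

/-- Either an element indexed by `B` shares a bucket with an element of `u`, counted by the double
sum, or `x` and `u` differ in at least `#B` thresholds. In the latter case all the bits there must
vanish for the hash values to agree. -/
theorem sum_bernoulliWeight_mul_le {t : ℕ} (i : Fin t → Fin d) (x u : Point s d)
    (B : Finset (Fin s)) {p : ℝ} (h0 : 0 ≤ p) (h1 : p ≤ 1) :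
    ∑ C : (Fin t → Bool) × Fin s → Bool, (∏ q, bernoulliWeight p (C q)) *
        (if hashValue i C x = hashValue i C u then 1 else 0) ≤
      ∑ j ∈ B, ∑ k, (if proj i (x j) = proj i (u k) then (1 : ℝ) else 0) + (1 - p) ^ #B := by
  classical
  have hsum : ∀ f : (Fin t → Bool) × Fin s → Bool → ℝ,
      ∑ C : (Fin t → Bool) × Fin s → Bool, ∏ q, f q (C q) = ∏ q, ∑ c, f q c := fun f => by
    rw [Finset.prod_univ_sum, Fintype.piFinset_univ]
  have hbw : ∑ c, bernoulliWeight p c = 1 := by simp [bernoulliWeight]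
  have hnn : 0 ≤ ∑ j ∈ B, ∑ k, (if proj i (x j) = proj i (u k) then (1 : ℝ) else 0) :=
    Finset.sum_nonneg fun _ _ => Finset.sum_nonneg fun _ _ => by positivity
  by_cases hcol : ∃ j ∈ B, ∃ k, proj i (x j) = proj i (u k)
  · obtain ⟨j, hj, k, hjk⟩ := hcol
    have hone : 1 ≤ ∑ j ∈ B, ∑ k, (if proj i (x j) = proj i (u k) then (1 : ℝ) else 0) := by
      calc (1 : ℝ) = if proj i (x j) = proj i (u k) then (1 : ℝ) else 0 := (if_pos hjk).symm
        _ ≤ ∑ k, (if proj i (x j) = proj i (u k) then (1 : ℝ) else 0) :=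
          Finset.single_le_sum (f := fun k => if proj i (x j) = proj i (u k) then (1 : ℝ) else 0)
            (fun _ _ => by positivity) (Finset.mem_univ k)
        _ ≤ _ := Finset.single_le_sum
          (f := fun j => ∑ k, if proj i (x j) = proj i (u k) then (1 : ℝ) else 0)
          (fun _ _ => Finset.sum_nonneg fun _ _ => by positivity) hj
    calc _ ≤ ∑ C : (Fin t → Bool) × Fin s → Bool, ∏ q, bernoulliWeight p (C q) := by
          refine Finset.sum_le_sum fun C _ => mul_le_of_le_one_right
            (Finset.prod_nonneg fun q _ => bernoulliWeight_nonneg h0 h1 _) ?_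
          split_ifs <;> norm_num
      _ = 1 := by rw [hsum (fun _ c => bernoulliWeight p c), hbw, Finset.prod_const_one]
      _ ≤ _ := by linarith [pow_nonneg (sub_nonneg.2 h1) #B]
  · push Not at hcol
    have hcard := card_le_card_chi_ne i x u B hcol
    set Q := univ.filter fun q : (Fin t → Bool) × Fin s => chi i x q.1 q.2 ≠ chi i u q.1 q.2
    calc _ ≤ ∑ C : (Fin t → Bool) × Fin s → Bool,
          ∏ q, (if q ∈ Q ∧ C q = true then 0 else bernoulliWeight p (C q)) := by
          refine Finset.sum_le_sum fun C _ => ?_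
          split_ifs with h
          · rw [mul_one]
            refine (Finset.prod_congr rfl fun q _ => ?_).le
            rw [if_neg]
            rintro ⟨hq, hC⟩
            have := congrFun h q
            simp only [hashValue, hC, Bool.true_and] at this
            exact (Finset.mem_filter.1 hq).2 this
          · rw [mul_zero]
            refine Finset.prod_nonneg fun q _ => ?_
            split_ifs
            · exact le_rfl
            · exact bernoulliWeight_nonneg h0 h1 _
      _ = ∏ q, if q ∈ Q then 1 - p else 1 := by
          rw [hsum (fun q c => if q ∈ Q ∧ c = true then 0 else bernoulliWeight p c)]
          refine Finset.prod_congr rfl fun q _ => ?_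
          by_cases hq : q ∈ Q <;> simp [hq, bernoulliWeight]
      _ = (1 - p) ^ #Q := by
          rw [Finset.prod_ite_mem, Finset.univ_inter, Finset.prod_const]
      _ ≤ (1 - p) ^ #B := pow_le_pow_of_le_one (by linarith) (by linarith) hcard
      _ ≤ _ := by linarith

/-- The indices of the elements of `x` at distance more than `R` from all elements of `u`. -/
noncomputable def farIndices (R : ℝ) (x u : Point s d) : Finset (Fin s) :=
  univ.filter fun j => ∀ k, R < hammingDist (x j) (u k)

theorem bitProb_mem (d : ℕ) {τ : ℝ} (hτ : 0 < τ) (ℓ : ℕ) :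
    0 ≤ bitProb d τ ℓ ∧ bitProb d τ ℓ ≤ 1 :=
  ⟨le_min zero_le_one (by positivity), min_le_left _ _⟩

/-- The previous bound is applied with `B` the far indices. The radius `Z * d / 2 ^ ℓ` is chosen so
that `2 ^ ℓ` random coordinates fail to separate a far pair with probability at most `exp (-Z)`, and
there are at most `s ^ 2` pairs. -/
theorem collisionProb_le (hd : 0 < d) (μ : PMF (Point s d)) {τ : ℝ} (hτ : 0 < τ) (ℓ : ℕ)
    (x : Point s d) (Z : ℝ) :
    collisionProb μ τ ℓ x ≤ ∑ u, (μ u).toReal * ((s : ℝ) ^ 2 * Real.exp (-Z) +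
      (1 - bitProb d τ ℓ) ^ #(farIndices (Z * d / 2 ^ ℓ) x u)) := by
  have : Nonempty (Fin d) := ⟨⟨0, hd⟩⟩
  have hd' : (0 : ℝ) < d := by exact_mod_cast hd
  obtain ⟨hp0, hp1⟩ := bitProb_mem d hτ ℓ
  refine Finset.sum_le_sum fun u _ => mul_le_mul_of_nonneg_left ?_ ENNReal.toReal_nonneg
  set B := farIndices (Z * d / 2 ^ ℓ) x u with hB
  calc _ ≤ 𝔼 i : Fin (2 ^ ℓ) → Fin d, (∑ j ∈ B, ∑ k,
        (if proj i (x j) = proj i (u k) then (1 : ℝ) else 0) + (1 - bitProb d τ ℓ) ^ #B) :=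
        Finset.expect_le_expect fun i _ => sum_bernoulliWeight_mul_le i x u B hp0 hp1
    _ = ∑ j ∈ B, ∑ k, 𝔼 i : Fin (2 ^ ℓ) → Fin d,
        (if proj i (x j) = proj i (u k) then (1 : ℝ) else 0) + (1 - bitProb d τ ℓ) ^ #B := by
        rw [Finset.expect_add_distrib, Fintype.expect_const, Finset.expect_sum_comm]
        congr 1
        exact Finset.sum_congr rfl fun j _ => Finset.expect_sum_comm _ _ _
    _ ≤ ∑ j ∈ B, ∑ _k : Fin s, Real.exp (-Z) + (1 - bitProb d τ ℓ) ^ #B := by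
        gcongr with j hj k _
        have hfar : Z * d / 2 ^ ℓ < hammingDist (x j) (u k) := (Finset.mem_filter.1 hj).2 k
        have h := expect_agree_le (J := Fin (2 ^ ℓ)) hd (x j) (u k)
        have heq : ∀ i : Fin (2 ^ ℓ) → Fin d, proj i (x j) = proj i (u k) ↔
            ∀ l, x j (i l) = u k (i l) := fun i => funext_iff
        simp_rw [heq]
        refine (le_of_eq (Finset.expect_congr rfl fun g _ => by congr)).trans (h.trans ?_)
        refine Real.exp_le_exp.2 (neg_le_neg ?_)
        rw [div_lt_iff₀ (by positivity)] at hfar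
        rw [Fintype.card_fin, div_mul_eq_mul_div, le_div_iff₀ hd']
        push_cast
        linarith
    _ ≤ _ := by
        simp only [Finset.sum_const, Finset.card_univ, Fintype.card_fin, nsmul_eq_mul]
        have hBs : (#B : ℝ) ≤ s := by exact_mod_cast (by simpa using Finset.card_le_univ B)
        have he := (Real.exp_pos (-Z)).le
        have : (#B : ℝ) * (s * Real.exp (-Z)) ≤ s * (s * Real.exp (-Z)) := by gcongr
        linarith

/-- A sample from `μ` is close to all but a few elements of a locally dense point with
probability at least `α / 2`. -/
theorem half_le_prob_card_farIndices_le (hd : 0 < d) (μ : PMF (Point s d)) {α τ Z : ℝ}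
    (hα : 0 < α) (hα1 : α ≤ 1) (hτ : 0 < τ) (hZ : (s : ℝ) ^ 2 * Real.exp (-Z) ≤ α / 4) {ℓ : ℕ}
    {x : Point s d} (hx : α ≤ collisionProb μ τ ℓ x) :
    ∑ u, (μ u).toReal * (if τ * 2 ^ (ℓ + 1) / d * Real.log (4 / α) <
      #(farIndices (Z * d / 2 ^ ℓ) x u) then 1 else 0) ≤ 1 - α / 2 := by
  have hd' : (0 : ℝ) < d := by exact_mod_cast hd
  obtain ⟨hp0, hp1⟩ := bitProb_mem d hτ ℓ
  set q := τ * 2 ^ (ℓ + 1) / d * Real.log (4 / α) with hq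
  have hlog : 0 ≤ Real.log (4 / α) := Real.log_nonneg (by rw [le_div_iff₀ hα]; linarith)
  have hq0 : 0 ≤ q := by positivity
  -- The threshold `q` is `log (4 / α)` divided by the untruncated bit probability. If the
  -- probability is truncated to `1`, one far element already excludes a collision.
  have hpow : ∀ n : ℕ, q < n → (1 - bitProb d τ ℓ) ^ n ≤ α / 4 := by
    intro n hn
    have hn0 : n ≠ 0 := by rintro rfl; simp at hn; linarith
    rcases le_total 1 ((d : ℝ) / (τ * 2 ^ (ℓ + 1))) with h | h
    · rw [bitProb, min_eq_left h, sub_self, zero_pow hn0]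
      linarith
    · have hb : bitProb d τ ℓ = d / (τ * 2 ^ (ℓ + 1)) := min_eq_right h
      calc (1 - bitProb d τ ℓ) ^ n ≤ Real.exp (-bitProb d τ ℓ) ^ n :=
            pow_le_pow_left₀ (by linarith) (Real.one_sub_le_exp_neg _) _
        _ = Real.exp (-(n * bitProb d τ ℓ)) := by rw [← Real.exp_nat_mul]; congr 1; ring
        _ ≤ Real.exp (-Real.log (4 / α)) := by
            refine Real.exp_le_exp.2 (neg_le_neg ?_)
            calc Real.log (4 / α) = q * bitProb d τ ℓ := by rw [hq, hb]; field_simp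
              _ ≤ n * bitProb d τ ℓ := by gcongr
        _ = α / 4 := by rw [← Real.log_inv, Real.exp_log (by positivity), inv_div]
  have h1 := hx.trans (collisionProb_le hd μ hτ ℓ x Z)
  have h2 : ∑ u, (μ u).toReal * ((s : ℝ) ^ 2 * Real.exp (-Z) +
      (1 - bitProb d τ ℓ) ^ #(farIndices (Z * d / 2 ^ ℓ) x u)) ≤
      ∑ u, (μ u).toReal * (1 + α / 2 -
        if q < #(farIndices (Z * d / 2 ^ ℓ) x u) then 1 else 0) := by
    refine Finset.sum_le_sum fun u _ => mul_le_mul_of_nonneg_left ?_ ENNReal.toReal_nonneg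
    split_ifs with h
    · linarith [hpow _ h]
    · have : (1 - bitProb d τ ℓ) ^ #(farIndices (Z * d / 2 ^ ℓ) x u) ≤ 1 :=
        pow_le_one₀ (by linarith) (by linarith)
      linarith
  simp_rw [mul_sub] at h2
  rw [Finset.sum_sub_distrib, ← Finset.sum_mul, sum_pmf_toReal] at h2
  linarith

/-- The expected number of elements of a locally dense point that are far from the sample. -/
theorem sampleMean_card_far_le (hd : 0 < d) (μ : PMF (Point s d)) {α τ Z : ℝ}
    (hα : 0 < α) (hα1 : α ≤ 1) (hτ : 0 < τ)
    (hZ : (s : ℝ) ^ 2 * Real.exp (-Z) ≤ α / 4) {ℓ : ℕ}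
    {x : Point s d} (hx : α ≤ collisionProb μ τ ℓ x) :
    sampleMean μ m (fun Y => ∑ j,
        if Z * d / 2 ^ ℓ < distTo (x j) (sampleSet Y) then (1 : ℝ) else 0) ≤
      τ * 2 ^ (ℓ + 1) / d * Real.log (4 / α) + s * Real.exp (-(α * m / 2)) := by
  have hd' : (0 : ℝ) < d := by exact_mod_cast hd
  have hmain := half_le_prob_card_farIndices_le hd μ hα hα1 hτ hZ hx
  set q := τ * 2 ^ (ℓ + 1) / d * Real.log (4 / α) with hq
  set R := Z * d / 2 ^ ℓ with hR
  have hlog : 0 ≤ Real.log (4 / α) := Real.log_nonneg (by rw [le_div_iff₀ hα]; linarith)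
  have hq0 : 0 ≤ q := by positivity
  -- A single good sample leaves at most `q` far elements. Only if all `m` samples are bad is the
  -- trivial bound `s` needed.
  have hpt : ∀ Y : Fin m → Point s d,
      (∑ j, if R < distTo (x j) (sampleSet Y) then (1 : ℝ) else 0) ≤
      q + s * ∏ t, (if q < #(farIndices R x (Y t)) then (1 : ℝ) else 0) := by
    intro Y
    rw [Finset.sum_boole]
    have hsub : ∀ t, (univ.filter fun j => R < distTo (x j) (sampleSet Y)) ⊆
        farIndices R x (Y t) := by
      intro t j hj
      refine Finset.mem_filter.2 ⟨Finset.mem_univ _, fun k => ?_⟩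
      refine (Finset.mem_filter.1 hj).2.trans_le ?_
      exact_mod_cast distTo_le (x j)
        (Finset.mem_filter.2 ⟨Finset.mem_univ _, t, k, rfl⟩ : Y t k ∈ sampleSet Y)
    by_cases hall : ∀ t, q < #(farIndices R x (Y t))
    · simp only [hall, if_true, Finset.prod_const_one, mul_one]
      have : (#(univ.filter fun j => R < distTo (x j) (sampleSet Y)) : ℝ) ≤ s := by
        exact_mod_cast (by simpa using
          Finset.card_le_univ (univ.filter fun j => R < distTo (x j) (sampleSet Y)))
      linarith
    · push Not at hall
      obtain ⟨t, ht⟩ := hall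
      have h1 : (#(univ.filter fun j => R < distTo (x j) (sampleSet Y)) : ℝ) ≤ q :=
        le_trans (by exact_mod_cast Finset.card_le_card (hsub t)) ht
      have h2 : 0 ≤ ∏ t, (if q < #(farIndices R x (Y t)) then (1 : ℝ) else 0) :=
        Finset.prod_nonneg fun _ _ => by positivity
      nlinarith [(Nat.cast_nonneg s : (0 : ℝ) ≤ s)]
  refine (sampleMean_mono μ hpt).trans ?_
  rw [sampleMean_add, sampleMean_const, sampleMean_const_mul,
    sampleMean_prod μ m (fun u => if q < #(farIndices R x u) then (1 : ℝ) else 0)]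
  gcongr
  calc _ ≤ (1 - α / 2) ^ m := by
        refine pow_le_pow_left₀ (Finset.sum_nonneg fun u _ => ?_) hmain _
        exact mul_nonneg ENNReal.toReal_nonneg (by positivity)
    _ ≤ Real.exp (-(α / 2)) ^ m :=
        pow_le_pow_left₀ (by linarith) (Real.one_sub_le_exp_neg _) _
    _ = _ := by rw [← Real.exp_nat_mul]; congr 1; ring

/-- At the first level whose radius `Z * d / 2 ^ ℓ` lies below `r`, the previous radius is at least
`r`, so the single term of that level already dominates `r`. Distances up to `Z` are absorbed by the
additive term. -/
theorem le_dyadic_sum {r Z : ℝ} (hd : 0 < d) (hdL : (d : ℝ) ≤ 2 ^ L) (hZ : 1 ≤ Z) (hr : r ≤ d) :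
    r ≤ Z + ∑ ℓ ∈ range (L + 1), 2 * Z * d / 2 ^ ℓ * (if Z * d / 2 ^ ℓ < r then 1 else 0) := by
  have hd' : (0 : ℝ) < d := by exact_mod_cast hd
  have h0 : ∀ ℓ : ℕ, 0 ≤ 2 * Z * d / 2 ^ ℓ * (if Z * d / 2 ^ ℓ < r then (1 : ℝ) else 0) :=
    fun ℓ => by positivity
  by_cases hrZ : r ≤ Z
  · linarith [Finset.sum_nonneg fun ℓ (_ : ℓ ∈ range (L + 1)) => h0 ℓ]
  have hL : Z * d / 2 ^ L < r := by
    refine lt_of_le_of_lt ?_ (not_le.1 hrZ)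
    rw [div_le_iff₀ (by positivity)]
    gcongr
  have hex : ∃ ℓ : ℕ, Z * d / 2 ^ ℓ < r := ⟨L, hL⟩
  classical
  obtain ⟨ℓ, hℓ, hmin, hℓL⟩ : ∃ ℓ : ℕ, Z * d / 2 ^ ℓ < r ∧
      (∀ i < ℓ, ¬ Z * d / 2 ^ i < r) ∧ ℓ ≤ L :=
    ⟨Nat.find hex, Nat.find_spec hex, fun i => Nat.find_min hex, Nat.find_min' hex hL⟩
  have hle : r ≤ 2 * Z * d / 2 ^ ℓ := by
    rcases ℓ with _ | ℓ
    · simp at hℓ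
      nlinarith
    · have := not_lt.1 (hmin ℓ (by omega))
      refine this.trans_eq ?_
      rw [pow_succ]
      field_simp
  have := Finset.single_le_sum (f := fun ℓ : ℕ => 2 * Z * d / 2 ^ ℓ *
    (if Z * d / 2 ^ ℓ < r then (1 : ℝ) else 0)) (fun i _ => h0 i)
    (Finset.mem_range.2 (Nat.lt_succ_of_le hℓL))
  simp only [hℓ, if_true, mul_one] at this
  linarith

/-- The expected total distance of the elements of a locally dense point to the sample. -/
theorem sampleMean_sum_distTo_le (hd : 0 < d) (hdL : (d : ℝ) ≤ 2 ^ L) (μ : PMF (Point s d))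
    {α τ Z : ℝ} (hα : 0 < α) (hα1 : α ≤ 1) (hτ : 0 < τ) (hs : 0 < s) (hm : 0 < m) (hZ1 : 1 ≤ Z)
    (hZ : (s : ℝ) ^ 2 * Real.exp (-Z) ≤ α / 4) {x : Point s d} (hx : LocallyDense L μ α τ x) :
    sampleMean μ m (fun Y => ∑ j, (distTo (x j) (sampleSet Y) : ℝ)) ≤
      s * Z + (L + 1) * (2 * Z * (2 * τ * Real.log (4 / α) +
        d * s * Real.exp (-(α * m / 2)))) := by
  have hd' : (0 : ℝ) < d := by exact_mod_cast hd
  have hpt : ∀ Y : Fin m → Point s d, ∑ j, (distTo (x j) (sampleSet Y) : ℝ) ≤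
      s * Z + ∑ ℓ ∈ range (L + 1), 2 * Z * d / 2 ^ ℓ *
        ∑ j, (if Z * d / 2 ^ ℓ < distTo (x j) (sampleSet Y) then (1 : ℝ) else 0) := by
    intro Y
    calc _ ≤ ∑ j : Fin s, (Z + ∑ ℓ ∈ range (L + 1), 2 * Z * d / 2 ^ ℓ *
          (if Z * d / 2 ^ ℓ < distTo (x j) (sampleSet Y) then (1 : ℝ) else 0)) := by
          refine Finset.sum_le_sum fun j _ => le_dyadic_sum hd hdL hZ1 ?_
          obtain ⟨z, -, hz⟩ := exists_distTo (x j) (sampleSet_nonempty hm hs Y)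
          rw [← hz]
          exact hammingDist_le _ _
      _ = _ := by
          rw [Finset.sum_add_distrib, Finset.sum_comm]
          simp_rw [← Finset.mul_sum]
          simp
  refine (sampleMean_mono μ hpt).trans ?_
  rw [sampleMean_add, sampleMean_const, sampleMean_sum]
  simp_rw [sampleMean_const_mul]
  gcongr
  calc _ ≤ ∑ _ℓ ∈ range (L + 1), 2 * Z * (2 * τ * Real.log (4 / α) +
        d * s * Real.exp (-(α * m / 2))) := by
        refine Finset.sum_le_sum fun ℓ hℓ => ?_
        have h := sampleMean_card_far_le (m := m) hd μ hα hα1 hτ hZ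
          (hx ℓ (Nat.lt_succ_iff.1 (Finset.mem_range.1 hℓ)))
        have hpow : (d : ℝ) / 2 ^ ℓ ≤ d := div_le_self hd'.le (one_le_pow₀ (by norm_num))
        -- The radius `d / 2 ^ ℓ` cancels the factor `2 ^ ℓ / d` in the number of far elements, so
        -- every level contributes the same multiple of `τ`.
        calc _ ≤ 2 * Z * d / 2 ^ ℓ * (τ * 2 ^ (ℓ + 1) / d * Real.log (4 / α) +
              s * Real.exp (-(α * m / 2))) := by gcongr
          _ = 2 * Z * (2 * τ * Real.log (4 / α) +
              d / 2 ^ ℓ * s * Real.exp (-(α * m / 2))) := by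
              rw [pow_succ]; field_simp
          _ ≤ _ := by gcongr
    _ = _ := by simp

theorem collisionProb_le_one (hd : 0 < d) (μ : PMF (Point s d)) {τ : ℝ} (hτ : 0 < τ) (ℓ : ℕ)
    (x : Point s d) : collisionProb μ τ ℓ x ≤ 1 := by
  have : Nonempty (Fin d) := ⟨⟨0, hd⟩⟩
  obtain ⟨hp0, hp1⟩ := bitProb_mem d hτ ℓ
  calc _ ≤ ∑ u, (μ u).toReal * 1 := by
        refine Finset.sum_le_sum fun u _ => mul_le_mul_of_nonneg_left ?_ ENNReal.toReal_nonneg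
        refine Finset.expect_le Finset.univ_nonempty fun i _ => ?_
        -- For the empty index set the bound is `0 + (1 - p) ^ 0 = 1`.
        simpa using sum_bernoulliWeight_mul_le i x u ∅ hp0 hp1
    _ = 1 := by simp [sum_pmf_toReal]

end Density

/-! ### The expected distance over a sampled tree -/

section Main

variable {s d L m : ℕ}

/-- A bound on the expected tree distance in terms of any bound `B` on the expected total distance
to the sample. -/
theorem expectedTreeEMD_le_of_sampleMean_le (hd : 0 < d) (hdL : (d : ℝ) ≤ 2 ^ L) {ξ : ℝ}
    (hξ : 0 ≤ ξ) (hm : 0 < m) (hs : 0 < s) (μ : PMF (Point s d)) {x y : Point s d} {B : ℝ}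
    (hB0 : 0 ≤ B) (hB : sampleMean μ m (fun Y => ∑ j, (distTo (x j) (sampleSet Y) : ℝ)) ≤ B) :
    expectedTreeEMD L μ m ξ x y ≤ emd x y * (48 + 32 * Real.log (1 + m * s * (d + 1)) +
      22 * ξ * (1 + Real.log (1 + B / emd x y))) := by
  obtain ⟨π, hπ⟩ := exists_eq_ciInf_of_finite
    (f := fun π : Equiv.Perm (Fin s) => ∑ i, (hammingDist (x i) (y (π i)) : ℝ))
  set E := emd x y with hE
  replace hπ : ∑ i, (hammingDist (x i) (y (π i)) : ℝ) = E := hπ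
  set D : Fin s → ℝ := fun i => (hammingDist (x i) (y (π i)) : ℝ) with hD
  have hD0 : ∀ i, 0 ≤ D i := fun i => Nat.cast_nonneg _
  have hE0 : 0 ≤ E := hπ ▸ Finset.sum_nonneg fun i _ => hD0 i
  set a := 48 + 32 * Real.log (1 + m * s * (d + 1)) with ha
  have hY := fun Y : Fin m → Point s d => expect_treeEMD_le hd hdL hξ hm hs Y x y π
  have hle : expectedTreeEMD L μ m ξ x y ≤ sampleMean μ m fun Y => ∑ i, D i * (a +
      22 * ξ * (1 + Real.log (1 + distTo (x i) (sampleSet Y) / D i))) := sampleMean_mono μ hY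
  rcases hE0.eq_or_lt with hE0 | hEpos
  · rw [← hE0, zero_mul]
    have hDz : ∀ i, D i = 0 := fun i =>
      (Finset.sum_eq_zero_iff_of_nonneg fun i _ => hD0 i).1 (hπ.trans hE0.symm) i
        (Finset.mem_univ i)
    simpa [hDz, sampleMean_const] using hle
  -- The tangent point is the value of `1 + r / D` for the totals `B` and `E`. Using the same
  -- tangent for all indices and samples performs both averages at once.
  set z₀ := 1 + B / E with hz
  have hz0 : 0 < z₀ := by positivity
  have hpt : ∀ Y : Fin m → Point s d, ∑ i, D i * (a +
      22 * ξ * (1 + Real.log (1 + distTo (x i) (sampleSet Y) / D i))) ≤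
      (E * a + 22 * ξ * (E * Real.log z₀ + E / z₀)) +
        22 * ξ / z₀ * ∑ i, (distTo (x i) (sampleSet Y) : ℝ) := by
    intro Y
    have hi : ∀ i ∈ univ, D i * (a +
        22 * ξ * (1 + Real.log (1 + distTo (x i) (sampleSet Y) / D i))) ≤
        D i * (a + 22 * ξ * (Real.log z₀ + 1 / z₀)) +
          22 * ξ / z₀ * distTo (x i) (sampleSet Y) := by
      intro i _
      set r : ℝ := (distTo (x i) (sampleSet Y) : ℝ) with hr
      have hr0 : 0 ≤ r := Nat.cast_nonneg _
      rcases (hD0 i).eq_or_lt with h0 | hpos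
      · rw [← h0, zero_mul, zero_mul, zero_add]
        positivity
      · have h := log_le_tangent (z := 1 + r / D i) (by positivity) hz0
        have h2 := mul_le_mul_of_nonneg_left h (by positivity : 0 ≤ D i * (22 * ξ))
        have e : D i * (22 * ξ) * (Real.log z₀ + (1 + r / D i) / z₀ - 1) =
            D i * (22 * ξ * (Real.log z₀ + 1 / z₀)) + 22 * ξ / z₀ * r - D i * (22 * ξ) := by
          field_simp
          ring
        rw [e] at h2
        linarith
    refine (Finset.sum_le_sum hi).trans_eq ?_
    rw [Finset.sum_add_distrib, ← Finset.sum_mul, ← Finset.mul_sum, hπ]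
    ring
  have h1 := hle.trans (sampleMean_mono μ hpt)
  rw [sampleMean_add, sampleMean_const, sampleMean_const_mul] at h1
  have h2 : 22 * ξ / z₀ * sampleMean μ m (fun Y => ∑ j, (distTo (x j) (sampleSet Y) : ℝ)) ≤
      22 * ξ / z₀ * B := by gcongr
  -- Since `E * z₀ = E + B`, the linear terms of the tangent sum to exactly what its constant `-1`
  -- removes.
  have h3 : 22 * ξ * (E / z₀) + 22 * ξ / z₀ * B = 22 * ξ * E := by
    have : E + B = E * z₀ := by rw [hz]; field_simp
    calc _ = 22 * ξ * (E + B) / z₀ := by ring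
      _ = _ := by rw [this]; field_simp
  linarith

/-- The expected total distance to the sample, in terms of `Λ = log (m s d / δ)`. -/
theorem sampleMean_sum_distTo_le_log (hd : 0 < d) (hs : 0 < s) (hdL : (d : ℝ) ≤ 2 ^ L)
    (μ : PMF (Point s d)) {α τ K Λ : ℝ} (hα : 0 < α) (hα1 : α ≤ 1) (hτ : 0 < τ) (hK : 2 ≤ K)
    (hΛ1 : 1 ≤ Λ) (hm : 0 < m) (hΛ : Real.log (m * s * d) ≤ Λ) (hαm : 4 / α ≤ m)
    (hexp : Real.log (s * d) ≤ α * m / 2) (hL : (L : ℝ) ≤ K * (Real.logb 2 d + 1))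
    {x : Point s d} (hx : LocallyDense L μ α τ x) :
    sampleMean μ m (fun Y => ∑ j, (distTo (x j) (sampleSet Y) : ℝ)) ≤
      (τ + s) * (34 * K * Λ ^ 3) := by
  have hd1 : (1 : ℝ) ≤ d := by exact_mod_cast hd
  have hs1 : (1 : ℝ) ≤ s := by exact_mod_cast hs
  have hm1 : (1 : ℝ) ≤ m := by exact_mod_cast hm
  have h4α : 4 ≤ 4 / α := by rw [le_div_iff₀ hα]; linarith
  have hl2 : (1 : ℝ) / 2 ≤ Real.log 2 := by linarith [Real.log_two_gt_d9]
  have hlog4 : 1 ≤ Real.log 4 := by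
    rw [show (4 : ℝ) = 2 ^ 2 by norm_num, Real.log_pow]
    push_cast
    linarith
  have hmsd : (m : ℝ) ≤ m * s * d := by
    calc (m : ℝ) = m * 1 * 1 := by ring
      _ ≤ _ := by gcongr
  have hssd : (s : ℝ) ≤ m * s * d := by
    calc (s : ℝ) = 1 * s * 1 := by ring
      _ ≤ _ := by gcongr
  have hdsd : (d : ℝ) ≤ m * s * d := by
    calc (d : ℝ) = 1 * 1 * d := by ring
      _ ≤ _ := by gcongr
  have hq : Real.log (4 / α) ≤ Λ :=
    (Real.log_le_log (by linarith) (hαm.trans hmsd)).trans hΛ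
  have hq0 : 0 ≤ Real.log (4 / α) := Real.log_nonneg (by linarith)
  -- This `Z` makes the chance of a far pair colliding, `s ^ 2 * exp (-Z)`, equal to `α / 4`.
  set Z := Real.log (s ^ 2 * (4 / α)) with hZdef
  have hZ1 : 1 ≤ Z := by
    refine hlog4.trans (Real.log_le_log (by norm_num) ?_)
    nlinarith
  have hZ2 : Z ≤ 2 * Λ := by
    have hsm : (s : ℝ) * m ≤ m * s * d := by
      calc (s : ℝ) * m = m * s * 1 := by ring
        _ ≤ _ := by gcongr
    have : Z ≤ Real.log ((m * s * d) ^ 2) := by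
      refine Real.log_le_log (by positivity) ?_
      calc (s : ℝ) ^ 2 * (4 / α) ≤ s ^ 2 * m := by gcongr
        _ = (s : ℝ) * (s * m) := by ring
        _ ≤ (m * s * d : ℝ) * (m * s * d) := by gcongr
        _ = _ := by ring
    rw [Real.log_pow] at this
    push_cast at this
    linarith
  have hZ : (s : ℝ) ^ 2 * Real.exp (-Z) ≤ α / 4 := by
    rw [Real.exp_neg, hZdef, Real.exp_log (by positivity)]
    refine le_of_eq ?_
    field_simp
  have hds : (d : ℝ) * s * Real.exp (-(α * m / 2)) ≤ 1 := by
    calc (d : ℝ) * s * Real.exp (-(α * m / 2)) ≤ d * s * Real.exp (-Real.log (s * d)) := by gcongr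
      _ = 1 := by
        rw [Real.exp_neg, Real.exp_log (by positivity)]
        field_simp
  have hL1 : (L : ℝ) + 1 ≤ 4 * K * Λ := by
    have hlogd : Real.log d ≤ Λ := (Real.log_le_log (by linarith) hdsd).trans hΛ
    have : Real.logb 2 d ≤ 2 * Λ := by
      rw [Real.logb, div_le_iff₀ (by linarith)]
      nlinarith
    nlinarith
  calc _ ≤ s * Z + (L + 1) * (2 * Z * (2 * τ * Real.log (4 / α) +
        d * s * Real.exp (-(α * m / 2)))) :=
        sampleMean_sum_distTo_le hd hdL μ hα hα1 hτ hs hm hZ1 hZ hx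
    _ ≤ s * (2 * Λ) + (4 * K * Λ) * (2 * (2 * Λ) * (2 * τ * Λ + 1)) := by gcongr
    -- As `s ≥ 1` and `Λ ≥ 1`, the additive `1` is absorbed into `2 * Λ * s`.
    _ ≤ (τ + s) * (2 * Λ) + (4 * K * Λ) * (2 * (2 * Λ) * (2 * Λ * (τ + s))) := by
        have : 2 * τ * Λ + 1 ≤ 2 * Λ * (τ + s) := by nlinarith
        gcongr
        linarith
    _ = (τ + s) * (2 * Λ + 32 * K * Λ ^ 3) := by ring
    _ ≤ _ := by
        gcongr
        have h3 : Λ ≤ Λ ^ 3 := le_self_pow₀ hΛ1 (by norm_num)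
        have : Λ * 2 ≤ Λ ^ 3 * K := mul_le_mul h3 hK (by norm_num) (by positivity)
        linarith

/-- The two logarithmic factors are absorbed into one constant. -/
theorem distortion_factor_le {ξ c A Λ lam ℓ u v : ℝ} (hξ : 0 ≤ ξ) (hξc : ξ ≤ c * Λ) (hc : 0 ≤ c)
    (hA : 0 ≤ A) (hΛ : 1 ≤ Λ) (hlam : 1 ≤ lam) (hℓ : 0 ≤ ℓ) (hu : u ≤ 2 * Λ)
    (hv : v ≤ A * lam + ℓ) :
    48 + 32 * u + 22 * ξ * (1 + v) ≤
      (112 + 44 * c + 22 * c * A) * Λ * lam ^ 1 * (1 + ℓ) := by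
  have p0 : 1 + ℓ ≤ lam * (1 + ℓ) := le_mul_of_one_le_left (by linarith) hlam
  have p1 : 1 ≤ lam * (1 + ℓ) := by linarith
  have p2 : ℓ ≤ lam * (1 + ℓ) := by linarith
  have p3 : lam ≤ lam * (1 + ℓ) := le_mul_of_one_le_right (by linarith) (by linarith)
  have h3 : 22 * ξ * (1 + v) ≤ 22 * ξ * (1 + (A * lam + ℓ)) := by gcongr
  have h4 : 22 * ξ * (1 + (A * lam + ℓ)) ≤ 22 * (c * Λ) * (1 + (A * lam + ℓ)) := by gcongr
  calc 48 + 32 * u + 22 * ξ * (1 + v)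
      ≤ 48 * Λ + 32 * (2 * Λ) + 22 * (c * Λ) * (1 + (A * lam + ℓ)) := by linarith
    _ = Λ * ((112 + 22 * c) * 1 + 22 * c * A * lam + 22 * c * ℓ) := by ring
    _ ≤ Λ * ((112 + 22 * c) * (lam * (1 + ℓ)) + 22 * c * A * (lam * (1 + ℓ)) +
        22 * c * (lam * (1 + ℓ))) := by gcongr
    _ = _ := by ring

end Main

end EMDHash

open EMDHash

theorem mainTheorem7 (c₁ c₂ K : ℝ) (hc₁ : 0 < c₁) (hc₂ : c₁ ≤ c₂) (hK : 2 ≤ K) :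
    ∃ (C₀ C : ℝ) (k : ℕ), 0 < C₀ ∧ 0 < C ∧
      ∀ (s d L m : ℕ) (μ : PMF (Point s d)) (α τ δ ξ : ℝ) (x y : Point s d),
        2 ≤ s * d →
        2 * Real.logb 2 d ≤ L → (L : ℝ) ≤ K * (Real.logb 2 d + 1) →
        0 < α → 0 < τ → 0 < δ → δ < 1 →
        c₁ * Real.log (m * s * d / δ) ≤ ξ → ξ ≤ c₂ * Real.log (m * s * d / δ) →
        LocallyDense L μ α τ x →
        C₀ * (Real.log (s * d) / α) ≤ m →
        expectedTreeEMD L μ m ξ x y ≤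
          emd x y *
            (C * Real.log (m * s * d / δ) * Real.log (Real.log (m * s * d / δ)) ^ k) *
            (1 + Real.log ((τ + s) / emd x y + 1)) := by
  have hc₂0 : 0 < c₂ := hc₁.trans_le hc₂
  have hlogK : 0 ≤ Real.log (34 * K) := Real.log_nonneg (by linarith)
  -- The number `32` makes `α * m ≥ 32 * log 2 ≥ 16`, enough for all later estimates. The second
  -- constant is that of `distortion_factor_le`, with `A = log (34 * K) + 3` coming from `log (34 *
  -- K * Λ ^ 3)`. That logarithm is the only source of a `log log`, so the exponent is `1`.
  refine ⟨32, 112 + 44 * c₂ + 22 * c₂ * (Real.log (34 * K) + 3), 1, by norm_num, by positivity,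
    ?_⟩
  intro s d L m μ α τ δ ξ x y hsd hL₁ hL₂ hα hτ hδ hδ1 hξ₁ hξ₂ hx hm₀
  have hs : 0 < s := Nat.pos_of_ne_zero (by rintro rfl; simp at hsd)
  have hd : 0 < d := Nat.pos_of_ne_zero (by rintro rfl; simp at hsd)
  have hd1 : (1 : ℝ) ≤ d := by exact_mod_cast hd
  have hs1 : (1 : ℝ) ≤ s := by exact_mod_cast hs
  have hsd' : (2 : ℝ) ≤ s * d := by exact_mod_cast hsd
  have hl2 : (1 : ℝ) / 2 ≤ Real.log 2 := by linarith [Real.log_two_gt_d9]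
  have hα1 : α ≤ 1 := (hx 0 (Nat.zero_le _)).trans (collisionProb_le_one hd μ hτ 0 x)
  have hdL : (d : ℝ) ≤ 2 ^ L := by
    have h0 : 0 ≤ Real.logb 2 d := Real.logb_nonneg (by norm_num) hd1
    have h1 : Real.logb 2 d ≤ L := by linarith
    rw [Real.logb_le_iff_le_rpow (by norm_num) (by linarith), Real.rpow_natCast] at h1
    exact h1
  have hlogsd : Real.log 2 ≤ Real.log (s * d) := Real.log_le_log (by norm_num) hsd'
  rw [mul_div_assoc', div_le_iff₀ hα] at hm₀
  have hαm : 4 / α ≤ m := by rw [div_le_iff₀ hα]; linarith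
  have hm16 : (16 : ℝ) ≤ m := by nlinarith [(Nat.cast_nonneg m : (0 : ℝ) ≤ m)]
  have hm : 0 < m := by
    have : (0 : ℝ) < m := by linarith
    exact_mod_cast this
  set n : ℝ := m * s * d with hn
  have hn32 : 32 ≤ n := by
    have : n = m * (s * d) := by rw [hn]; ring
    nlinarith
  set Λ := Real.log (n / δ) with hΛ
  have hnδ : n ≤ n / δ := by rw [le_div_iff₀ hδ]; nlinarith
  have hΛn : Real.log n ≤ Λ := Real.log_le_log (by linarith) hnδ
  -- `m * s * d ≥ 32` gives `Λ ≥ 5 * log 2 > e`, so that `log Λ ≥ 1` and the iterated logarithm can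
  -- absorb constants.
  have hΛe : Real.exp 1 ≤ Λ := by
    have h32 : Real.log 32 ≤ Real.log n := Real.log_le_log (by norm_num) hn32
    rw [show (32 : ℝ) = 2 ^ 5 by norm_num, Real.log_pow] at h32
    push_cast at h32
    linarith [Real.exp_one_lt_d9, Real.log_two_gt_d9]
  have hΛ1 : 1 ≤ Λ := by linarith [Real.add_one_le_exp (1 : ℝ)]
  set lam := Real.log Λ with hlam
  have hlam1 : 1 ≤ lam := (Real.le_log_iff_exp_le (by linarith)).2 hΛe
  have hξ : 0 ≤ ξ := le_trans (by positivity) hξ₁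
  have hB := sampleMean_sum_distTo_le_log hd hs hdL μ hα hα1 hτ hK hΛ1 hm hΛn hαm
    (by linarith) hL₂ hx
  have hmain := expectedTreeEMD_le_of_sampleMean_le (L := L) (y := y) hd hdL hξ hm hs μ
    (by positivity) hB
  refine hmain.trans ?_
  set E := emd x y with hE
  have hE0 : 0 ≤ E := Real.iInf_nonneg fun π => Finset.sum_nonneg fun i _ => Nat.cast_nonneg _
  rw [mul_assoc E]
  rcases hE0.eq_or_lt with hE0 | hEpos
  · rw [← hE0, zero_mul, zero_mul]
  refine mul_le_mul_of_nonneg_left ?_ hE0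
  have hτs : 0 < τ + s := by linarith
  set ℓ := Real.log ((τ + s) / E + 1) with hℓ
  have hℓ0 : 0 ≤ ℓ := Real.log_nonneg (by
    have : 0 ≤ (τ + s) / E := by positivity
    linarith)
  set M := 34 * K * Λ ^ 3 with hM
  have hM1 : 1 ≤ M := by
    exact one_le_mul_of_one_le_of_one_le (by linarith) (one_le_pow₀ hΛ1)
  have hlogM : Real.log M ≤ (Real.log (34 * K) + 3) * lam := by
    rw [hM, Real.log_mul (by positivity) (by positivity), Real.log_pow]
    push_cast
    have := mul_le_mul_of_nonneg_left hlam1 hlogK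
    linarith
  -- The polylogarithmic factor `M ≥ 1` is split off from the distance ratio as an additive `log M`.
  have hlog : Real.log (1 + (τ + s) * M / E) ≤ Real.log M + ℓ := by
    rw [hℓ, ← Real.log_mul (by positivity) (by positivity)]
    refine Real.log_le_log (by positivity) ?_
    have : M * ((τ + s) / E + 1) = M + (τ + s) * M / E := by ring
    linarith
  have hcard : Real.log (1 + m * s * (d + 1)) ≤ 2 * Λ := by
    have h1 : 1 + (m : ℝ) * s * (d + 1) ≤ n ^ 2 := by
      have h2 : (m : ℝ) * s ≤ n := by
        rw [hn]
        exact le_mul_of_one_le_right (by positivity) hd1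
      have h3 : (m : ℝ) * s * (d + 1) = n + m * s := by rw [hn]; ring
      nlinarith
    have h2 : Real.log (1 + m * s * (d + 1)) ≤ Real.log (n ^ 2) :=
      Real.log_le_log (by positivity) h1
    rw [Real.log_pow] at h2
    push_cast at h2
    linarith
  set A := Real.log (34 * K) + 3 with hA
  have hA0 : 0 ≤ A := by linarith
  exact distortion_factor_le hξ hξ₂ hc₂0.le hA0 hΛ1 hlam1 hℓ0 hcard (hlog.trans (by linarith))
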